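/- Let $X=(X,d,\mu)$ be a metric space equipped with a Borel measure $\mu$ (completed) such that $0<\mu(B)<\infty$ for all open balls $B\subset X$, let $1\le p<\infty$, and let $E\subset X$ be a bounded set. Curves are nonconstant, compact and rectifiable, and parameterized by arc length as $\gamma:[0,l_\gamma]\to X$. A property holds for $p$-almost every curve if there is a Borel function $\rho\ge 0$ in $L^p(X)$ such that $\int_\gamma\rho\,ds=\infty$ for every curve $\gamma$ for which it fails. A Borel function $g:X\to[0,\infty]$ is an upper gradient of $f:X\to[-\infty,\infty]$ if $|f(\gamma(0))-f(\gamma(l_\gamma))|\le\int_\gamma g\,ds$ for every curve $\gamma$ (the left-hand side being $\infty$ whenever both values are infinite); a measurable $g:X\to[0,\infty]$ is a $p$-weak upper gradient of $f$ if this holds for $p$-almost every curve. A minimal $p$-weak upper gradient $g_f$ of $f$ is a $p$-weak upper gradient in $L^p_{\rm loc}(X)$ with $g_f\le g$ a.e. for every $p$-weak upper gradient $g\in L^p_{\rm loc}(X)$ of $f$. The Newtonian space $N^{1,p}(X)$ consists of all everywhere defined measurable functions $u:X\to[-\infty,\infty]$ that have an upper gradient in $L^p_{\rm loc}(X)$ and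 satisfy $\int_X|u|^p\,d\mu+\int_X g_u^p\,d\mu<\infty$, and $N^{1,p}_0(E)$ consists of those $u\in N^{1,p}(X)$ with $u=0$ on $X\setminus E$. For $A\subset E$ the variational capacity is $$\operatorname{cap}_p(A,E)=\inf\Big\{\int_X g_u^p\,d\mu : u\in N^{1,p}_0(E),\ u\ge 1\text{ on }A\Big\},\qquad \inf\emptyset=\infty.$$ Let $A_1,A_2,\ldots\subset E$. Then the following hold. (i) $\operatorname{cap}_p(\emptyset,E)=0$. (ii) If $A_1\subset A_2\subset E$, then $\operatorname{cap}_p(A_1,E)\le\operatorname{cap}_p(A_2,E)$. (iii) If $A\subset E_1\subset E_2$ with $E_2\subset X$ bounded, then $\operatorname{cap}_p(A,E_2)\le\operatorname{cap}_p(A,E_1)$. (iv) $\operatorname{cap}_p(A_1\cup A_2,E)+\operatorname{cap}_p(A_1\cap A_2,E)\le\operatorname{cap}_p(A_1,E)+\operatorname{cap}_p(A_2,E)$. (v) $\operatorname{cap}_p\big(\bigcup_{i=1}^\infty A_i,E\big)\le\sum_{i=1}^\infty\operatorname{cap}_p(A_i,E)$, and $\operatorname{cap}_p(\,\cdot\,,E)$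 is an outer measure on the subsets of $E$. (vi) If $1<p<\infty$ and $A_1\subset A_2\subset\cdots\subset E$, then $\operatorname{cap}_p\big(\bigcup_{i=1}^\infty A_i,E\big)=\lim_{i\to\infty}\operatorname{cap}_p(A_i,E)$. (vii) If $F\subset E$ is closed as a subset of $X$, then $\operatorname{cap}_p(F,E)=\operatorname{cap}_p(\partial F,E)$, where $\partial F$ is the boundary of $F$ in $X$. -/

import Mathlib

open MeasureTheory Set Filter Topology
open scoped ENNReal

namespace NewtonianCapacity

/-- A nonconstant compact rectifiable curve in `X`, parameterized by arc length on `[0, len]`: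
the length of the piece over `[s, t]` is `t - s`. Only the values on `[0, len]` matter. -/
structure RectCurve (X : Type*) [PseudoEMetricSpace X] where
  len : ℝ
  len_pos : 0 < len
  toFun : ℝ → X
  unitSpeed : HasUnitSpeedOn toFun (Icc 0 len)

/-- The line integral `∫_γ g ds` of a nonnegative function. -/
noncomputable def lineIntegral {X : Type*} [PseudoEMetricSpace X]
    (γ : RectCurve X) (g : X → ℝ≥0∞) : ℝ≥0∞ :=
  ∫⁻ t in Icc 0 γ.len, g (γ.toFun t)

/-- The upper gradient inequality `|f(γ(0)) - f(γ(len))| ≤ ∫_γ g ds` on the curve `γ`. With the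
conventions of `EReal` the left-hand side is `∞` as soon as one of the two values is infinite,
also when both are; see `abs_sub_eq_top`. -/
def UGInequality {X : Type*} [PseudoEMetricSpace X]
    (f : X → EReal) (g : X → ℝ≥0∞) (γ : RectCurve X) : Prop :=
  (f (γ.toFun 0) - f (γ.toFun γ.len)).abs ≤ lineIntegral γ g

theorem abs_sub_eq_top (a b : EReal) (h : a = ⊤ ∨ a = ⊥ ∨ b = ⊤ ∨ b = ⊥) :
    (a - b).abs = ⊤ := by
  rcases h with rfl | rfl | rfl | rfl
  · induction b <;> simp
  · simp
  · simp
  · induction a <;> simp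

section

variable {X : Type*} [MetricSpace X] [MeasurableSpace X]

/-- `g` is an upper gradient of `f`: a nonnegative Borel function such that the upper gradient
inequality holds on every nonconstant compact rectifiable curve. -/
def IsUpperGradient (f : X → EReal) (g : X → ℝ≥0∞) : Prop :=
  Measurable g ∧ ∀ γ : RectCurve X, UGInequality f g γ

/-- The curve family `Γ` has zero `p`-modulus: some nonnegative Borel function in `L^p(X)` has
infinite integral along every curve of `Γ`. -/
def HasZeroModulus (p : ℝ) (μ : Measure X) (Γ : Set (RectCurve X)) : Prop :=
  ∃ ρ : X → ℝ≥0∞, Measurable ρ ∧ ∫⁻ x, ρ x ^ p ∂μ < ∞ ∧ ∀ γ ∈ Γ, lineIntegral γ ρ = ∞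

/-- `g` is a `p`-weak upper gradient of `f`: it is nonnegative and measurable for the completion
of `μ`, and for `p`-almost every curve `∫_γ g ds` is defined and the upper gradient
inequality holds. -/
def IsWeakUpperGradient (p : ℝ) (μ : Measure X) (f : X → EReal) (g : X → ℝ≥0∞) : Prop :=
  AEMeasurable g μ ∧
    HasZeroModulus p μ {γ : RectCurve X |
      ¬ (AEMeasurable (fun t => g (γ.toFun t)) (volume.restrict (Icc 0 γ.len)) ∧
          UGInequality f g γ)}

/-- The nonnegative function `g` belongs to `L^p_loc(X)`. -/
def MemLpLoc (p : ℝ) (μ : Measure X) (g : X → ℝ≥0∞) : Prop :=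
  AEMeasurable g μ ∧ ∀ x : X, ∃ r > 0, ∫⁻ y in Metric.ball x r, g y ^ p ∂μ < ∞

/-- `g` is a minimal `p`-weak upper gradient of `f`. Such a `g` is unique up to a.e. equality. -/
def IsMinimalWeakUpperGradient (p : ℝ) (μ : Measure X) (f : X → EReal) (g : X → ℝ≥0∞) : Prop :=
  IsWeakUpperGradient p μ f g ∧ MemLpLoc p μ g ∧
    ∀ g' : X → ℝ≥0∞, IsWeakUpperGradient p μ f g' → MemLpLoc p μ g' → g ≤ᵐ[μ] g'

/-- The energy `∫_X g_u^p dμ`, where `g_u` is the minimal `p`-weak upper gradient of `u`. All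
minimal `p`-weak upper gradients of `u` give the same integral, so the infimum only selects this
common value (it is `∞` if `u` has none). -/
noncomputable def energy (p : ℝ) (μ : Measure X) (u : X → EReal) : ℝ≥0∞ :=
  ⨅ (g : X → ℝ≥0∞) (_ : IsMinimalWeakUpperGradient p μ u g), ∫⁻ x, g x ^ p ∂μ

theorem energy_eq {p : ℝ} {μ : Measure X} {u : X → EReal} {g : X → ℝ≥0∞}
    (hg : IsMinimalWeakUpperGradient p μ u g) : energy p μ u = ∫⁻ x, g x ^ p ∂μ := by
  refine le_antisymm (iInf₂_le g hg) (le_iInf₂ fun g' hg' => ?_)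
  refine lintegral_mono_ae ?_
  filter_upwards [hg.2.2 g' hg'.1 hg'.2.1, hg'.2.2 g hg.1 hg.2.1] with x h1 h2
  rw [le_antisymm h1 h2]

/-- `‖u‖_{N^{1,p}(X)}`. -/
noncomputable def newtonianNorm (p : ℝ) (μ : Measure X) (u : X → EReal) : ℝ≥0∞ :=
  (∫⁻ x, (u x).abs ^ p ∂μ + energy p μ u) ^ (1 / p)

/-- The Newtonian space `N^{1,p}(X)`; its elements are functions defined everywhere. -/
def newtonianSpace (p : ℝ) (μ : Measure X) : Set (X → EReal) :=
  {u | AEMeasurable u μ ∧ (∃ g : X → ℝ≥0∞, IsUpperGradient u g ∧ MemLpLoc p μ g) ∧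
    newtonianNorm p μ u < ∞}

/-- The space `N^{1,p}_0(E)` of Newtonian functions with zero boundary values, its elements being
identified with their extensions by zero to `X`. -/
def newtonianSpaceZero (p : ℝ) (μ : Measure X) (E : Set X) : Set (X → EReal) :=
  {u | u ∈ newtonianSpace p μ ∧ ∀ x ∉ E, u x = 0}

/-- The variational capacity `cap_p(A, E)`, for `A ⊆ E`. -/
noncomputable def varCap (p : ℝ) (μ : Measure X) (A E : Set X) : ℝ≥0∞ :=
  ⨅ (u : X → EReal) (_ : u ∈ newtonianSpaceZero p μ E) (_ : ∀ x ∈ A, 1 ≤ u x), energy p μ u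

end

end NewtonianCapacity

/-! The variational capacity and its elementary properties.

For real-valued `v`, a function `g`, integrable along `p`-almost every curve, is a `p`-weak upper
gradient exactly when `v` is absolutely continuous along `p`-almost every curve `γ`, with
`|(v ∘ γ)'| ≤ g ∘ γ` almost everywhere; this follows from the fundamental theorem of calculus and
Lebesgue's differentiation theorem, applied to all subcurves at once (`eventually_subcurve`). It
makes weak upper gradients a pointwise matter: a countable infimum of them is one
(`isWeakUpperGradient_iInf`), and those of `v` and `w` can be glued along `{w < v}` to serve for
`max v w` and `min v w`. The infimum of a sequence minimizing `∫ g ^ p` is then a minimal weak upper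
gradient (`exists_isMinimalWeakUpperGradient`), so the capacity is the infimum of `∫ g ^ p` over all
pairs of a competitor with values in `[0, 1]` and a weak upper gradient of it: `Admissible`,
`Admissible.varCap_le`, `exists_admissible_of_varCap_lt`.

Strong subadditivity comes from `max` and `min` of two competitors, countable subadditivity from
suprema, since `(sup gᵢ) ^ p ≤ ∑ gᵢ ^ p`. Passing from `∂F` to `F` is possible because a curve can
reach a closed set `F` from outside only through `∂F`.

For continuity along increasing sequences, take near-minimizers `vⱼ` for `Aⱼ` with gradients `gⱼ`.
For `j ≤ k` the midpoint of `vⱼ` and `vₖ` competes for `Aⱼ`, so uniform convexity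
(`exists_ennreal_sub_rpow_le`) shows that the `gⱼ` are Cauchy in `L^p`; no weak compactness is
needed. Along a rapidly converging subsequence `liminf gⱼ` is a weak upper gradient of
`limsup vⱼ` (`isWeakUpperGradient_limsup`), and Fatou's lemma bounds its energy. The upper limit is
at least `1` at every point of `⋃ Aⱼ`, so no exceptional sets arise. -/

namespace NewtonianCapacity

/-! ### Curves -/

section Curves

variable {X : Type*} [MetricSpace X]

theorem RectCurve.continuousOn (γ : RectCurve X) : ContinuousOn γ.toFun (Icc 0 γ.len) := by
  have h : LipschitzOnWith 1 γ.toFun (Icc 0 γ.len) := by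
    intro x hx y hy
    wlog hxy : x ≤ y generalizing x y
    · rw [edist_comm, edist_comm x y]
      exact this hy hx (le_of_not_ge hxy)
    have h1 := γ.unitSpeed hx hy
    have h2 := eVariationOn.edist_le γ.toFun (s := Icc 0 γ.len ∩ Icc x y)
      ⟨hx, le_rfl, hxy⟩ ⟨hy, hxy, le_rfl⟩
    rw [h1] at h2
    refine h2.trans ?_
    rw [edist_dist, dist_comm, Real.dist_eq, abs_of_nonneg (sub_nonneg.2 hxy)]
    simp
  exact h.continuousOn

/-- Along a curve that leaves the closed set `F`, the last point in `F` lies on `∂F`. -/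
theorem exists_last_mem_frontier {γ : RectCurve X} {F : Set X} (hF : IsClosed F)
    (h0 : γ.toFun 0 ∈ F) (h1 : γ.toFun γ.len ∉ F) :
    ∃ t ∈ Icc 0 γ.len, γ.toFun t ∈ frontier F := by
  have hcl := γ.continuousOn.preimage_isClosed_of_isClosed isClosed_Icc hF
  obtain ⟨t, ht, hmax⟩ := (isCompact_Icc.of_isClosed_subset hcl inter_subset_left).exists_isGreatest
    ⟨0, ⟨le_rfl, γ.len_pos.le⟩, h0⟩
  refine ⟨t, ht.1, ?_⟩
  have htl : t < γ.len := lt_of_le_of_ne ht.1.2 fun h => h1 (h ▸ ht.2)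
  rw [frontier_eq_closure_inter_closure]
  refine ⟨subset_closure ht.2, ?_⟩
  refine ((γ.continuousOn t ht.1).mono (t := Icc 0 γ.len) (s := Ioc t γ.len)
    fun s hs => ⟨ht.1.1.trans hs.1.le, hs.2⟩).mem_closure ?_ fun s hs hsF => ?_
  · rw [closure_Ioc htl.ne]; exact left_mem_Icc.2 htl.le
  · exact absurd (hmax ⟨⟨ht.1.1.trans hs.1.le, hs.2⟩, hsF⟩) (not_le.2 hs.1)

/-- Along a curve that enters the closed set `F`, the first point in `F` lies on `∂F`. -/
theorem exists_first_mem_frontier {γ : RectCurve X} {F : Set X} (hF : IsClosed F)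
    (h0 : γ.toFun 0 ∉ F) (h1 : γ.toFun γ.len ∈ F) :
    ∃ t ∈ Icc 0 γ.len, γ.toFun t ∈ frontier F := by
  have hcl := γ.continuousOn.preimage_isClosed_of_isClosed isClosed_Icc hF
  obtain ⟨t, ht, hmin⟩ := (isCompact_Icc.of_isClosed_subset hcl inter_subset_left).exists_isLeast
    ⟨γ.len, ⟨γ.len_pos.le, le_rfl⟩, h1⟩
  refine ⟨t, ht.1, ?_⟩
  have htl : 0 < t := lt_of_le_of_ne ht.1.1 fun h => h0 (h ▸ ht.2)
  rw [frontier_eq_closure_inter_closure]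
  refine ⟨subset_closure ht.2, ?_⟩
  refine ((γ.continuousOn t ht.1).mono (t := Icc 0 γ.len) (s := Ico 0 t)
    fun s hs => ⟨hs.1, hs.2.le.trans ht.1.2⟩).mem_closure ?_ fun s hs hsF => ?_
  · rw [closure_Ico htl.ne]; exact right_mem_Icc.2 htl.le
  · exact absurd (hmin ⟨⟨hs.1, hs.2.le.trans ht.1.2⟩, hsF⟩) (not_le.2 hs.2)

/-- The piece of `γ` over `[s, t]`, reparameterized to start at time `0`. -/
def RectCurve.subcurve (γ : RectCurve X) (s t : ℝ) (hs : 0 ≤ s) (hst : s < t) (ht : t ≤ γ.len) :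
    RectCurve X where
  len := t - s
  len_pos := sub_pos.2 hst
  toFun τ := γ.toFun (s + τ)
  unitSpeed := by
    refine hasConstantSpeedOnWith_iff_ordered.2 fun x hx y hy hxy => ?_
    have h1 : Icc 0 (t - s) ∩ Icc x y = Icc x y :=
      inter_eq_right.2 (Icc_subset_Icc hx.1 hy.2)
    have h2 := eVariationOn.comp_eq_of_monotoneOn γ.toFun (t := Icc x y) (fun τ => s + τ)
      (fun a _ b _ hab => by simpa using hab)
    rw [h1]
    change eVariationOn (γ.toFun ∘ fun τ => s + τ) (Icc x y) = _
    rw [h2, image_const_add_Icc]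
    have hx' : s + x ∈ Icc 0 γ.len := ⟨by linarith [hx.1], by linarith [hx.2]⟩
    have hy' : s + y ∈ Icc 0 γ.len := ⟨by linarith [hy.1], by linarith [hy.2]⟩
    have h3 := γ.unitSpeed hx' hy'
    rw [inter_eq_right.2 (Icc_subset_Icc hx'.1 hy'.2)] at h3
    rw [h3]
    simp

theorem lineIntegral_subcurve (γ : RectCurve X) {s t : ℝ} (hs : 0 ≤ s) (hst : s < t)
    (ht : t ≤ γ.len) (g : X → ℝ≥0∞) :
    lineIntegral (γ.subcurve s t hs hst ht) g = ∫⁻ τ in Icc s t, g (γ.toFun τ) := by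
  have h := (measurePreserving_add_left (volume : Measure ℝ) s).setLIntegral_comp_preimage_emb
    (measurableEmbedding_addLeft s) (fun τ => g (γ.toFun τ)) (Icc s t)
  rw [← h]
  simp [lineIntegral, RectCurve.subcurve]

theorem lineIntegral_mono (γ : RectCurve X) {f g : X → ℝ≥0∞} (h : ∀ x, f x ≤ g x) :
    lineIntegral γ f ≤ lineIntegral γ g :=
  lintegral_mono fun _ => h _

theorem ugInequality_coe_iff {v : X → ℝ} {g : X → ℝ≥0∞} {γ : RectCurve X} :
    UGInequality (fun x => (v x : EReal)) g γ ↔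
      edist (v (γ.toFun 0)) (v (γ.toFun γ.len)) ≤ lineIntegral γ g := by
  rw [UGInequality, ← EReal.coe_sub, EReal.abs_def, edist_dist, Real.dist_eq]

end Curves

/-! ### Almost every curve -/

theorem iSup_rpow_le_tsum {ι : Type*} {p : ℝ} (hp : 0 < p) (a : ι → ℝ≥0∞) :
    (⨆ i, a i) ^ p ≤ ∑' i, a i ^ p := by
  rw [← ENNReal.le_rpow_inv_iff hp]
  refine iSup_le fun i => ?_
  rw [ENNReal.le_rpow_inv_iff hp]
  exact ENNReal.le_tsum (f := fun i => a i ^ p) i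

section Modulus

variable {X : Type*} [MetricSpace X] [MeasurableSpace X] {p : ℝ} {μ : Measure X}

theorem HasZeroModulus.mono {Γ Γ' : Set (RectCurve X)} (h : HasZeroModulus p μ Γ)
    (hs : Γ' ⊆ Γ) : HasZeroModulus p μ Γ' := by
  obtain ⟨ρ, h1, h2, h3⟩ := h
  exact ⟨ρ, h1, h2, fun γ hγ => h3 γ (hs hγ)⟩

/-- The supremum of suitably scaled test functions works for the union; unlike their sum, it needs
no Minkowski inequality. -/
theorem hasZeroModulus_iUnion {ι : Type*} [Countable ι] (hp : 0 < p) {Γ : ι → Set (RectCurve X)}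
    (h : ∀ i, HasZeroModulus p μ (Γ i)) : HasZeroModulus p μ (⋃ i, Γ i) := by
  choose ρ hρm hρ hΓ using h
  obtain ⟨δ, hδ, hsum⟩ := ENNReal.exists_pos_sum_of_countable' (one_ne_zero (α := ℝ≥0∞)) ι
  let I : ι → ℝ≥0∞ := fun i => ∫⁻ x, ρ i x ^ p ∂μ
  let c : ι → ℝ≥0∞ := fun i => (δ i / (I i + 1)) ^ p⁻¹
  -- With this scaling `∫ (c i * ρ i) ^ p ≤ δ i`; the `+ 1` keeps `c i` finite when `I i = 0`.
  have hI : ∀ i, I i + 1 ≠ ∞ := fun i => ENNReal.add_ne_top.2 ⟨(hρ i).ne, ENNReal.one_ne_top⟩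
  have hc : ∀ i, c i ≠ 0 := fun i =>
    (ENNReal.rpow_pos (ENNReal.div_pos (hδ i).ne' (hI i))
      (ENNReal.div_lt_top (ENNReal.ne_top_of_tsum_ne_top (hsum.trans ENNReal.one_lt_top).ne i)
        (by simp)).ne).ne'
  have hcp : ∀ i, c i ^ p = δ i / (I i + 1) := fun i => ENNReal.rpow_inv_rpow hp.ne' _
  refine ⟨fun x => ⨆ i, c i * ρ i x, .iSup fun i => (hρm i).const_mul _, ?_, fun γ hγ => ?_⟩
  · calc ∫⁻ x, (⨆ i, c i * ρ i x) ^ p ∂μ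
        ≤ ∫⁻ x, ∑' i, (c i * ρ i x) ^ p ∂μ := lintegral_mono fun x => iSup_rpow_le_tsum hp _
      _ = ∑' i, ∫⁻ x, (c i * ρ i x) ^ p ∂μ :=
        lintegral_tsum fun i => (((hρm i).const_mul _).pow_const _).aemeasurable
      _ ≤ ∑' i, δ i := by
        refine ENNReal.tsum_le_tsum fun i => ?_
        simp_rw [ENNReal.mul_rpow_of_nonneg _ _ hp.le]
        rw [lintegral_const_mul _ ((hρm i).pow_const _), hcp]
        calc δ i / (I i + 1) * I i ≤ δ i / (I i + 1) * (I i + 1) := by gcongr; simp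
          _ = δ i := ENNReal.div_mul_cancel (by simp) (hI i)
      _ < ∞ := hsum.trans ENNReal.one_lt_top
  · obtain ⟨i, hi⟩ := mem_iUnion.1 hγ
    rw [eq_top_iff]
    calc ∞ = c i * lineIntegral γ (ρ i) := by rw [hΓ i γ hi, ENNReal.mul_top (hc i)]
      _ ≤ lineIntegral γ (fun x => c i * ρ i x) := lintegral_const_mul_le _ _
      _ ≤ _ := lineIntegral_mono γ fun x => le_iSup (fun i => c i * ρ i x) i

/-- The filter of curve families whose complement has zero `p`-modulus, so that
`∀ᶠ γ in aeCurve μ hp, P γ` says that `P` holds for `p`-almost every curve. -/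
def aeCurve (μ : Measure X) {p : ℝ} (hp : 0 < p) : Filter (RectCurve X) :=
  Filter.ofCountableUnion {Γ | HasZeroModulus p μ Γ}
    (fun S hS h => by
      have := hS.to_subtype
      rw [sUnion_eq_iUnion]
      exact hasZeroModulus_iUnion hp fun i => h i i.2)
    (fun _ ht _ hs => HasZeroModulus.mono ht hs)

instance (hp : 0 < p) : CountableInterFilter (aeCurve μ hp) := by
  unfold aeCurve; infer_instance

theorem eventually_aeCurve {hp : 0 < p} {P : RectCurve X → Prop} :
    (∀ᶠ γ in aeCurve μ hp, P γ) ↔ HasZeroModulus p μ {γ | ¬ P γ} := Iff.rfl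

theorem eventually_lineIntegral_lt_top_of_measurable (hp : 0 < p) {ρ : X → ℝ≥0∞}
    (hm : Measurable ρ) (hρ : ∫⁻ x, ρ x ^ p ∂μ < ∞) :
    ∀ᶠ γ in aeCurve μ hp, lineIntegral γ ρ < ∞ :=
  eventually_aeCurve.2 ⟨ρ, hm, hρ, fun _ hγ => not_lt_top_iff.1 hγ⟩

/-- A `p`-almost every statement about curves passes to all subcurves, since the line integral of
the test function only decreases. -/
theorem eventually_subcurve {hp : 0 < p} {P : RectCurve X → Prop}
    (h : ∀ᶠ γ in aeCurve μ hp, P γ) :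
    ∀ᶠ γ in aeCurve μ hp, ∀ (s t : ℝ) (hs : 0 ≤ s) (hst : s < t) (ht : t ≤ γ.len),
      P (γ.subcurve s t hs hst ht) := by
  obtain ⟨ρ, hm, hρ, hΓ⟩ := eventually_aeCurve.1 h
  filter_upwards [eventually_lineIntegral_lt_top_of_measurable hp hm hρ] with γ hγ s t hs hst ht
  by_contra hP
  have h1 := hΓ _ hP
  rw [lineIntegral_subcurve] at h1
  have h2 : ∫⁻ τ in Icc s t, ρ (γ.toFun τ) ≤ lineIntegral γ ρ :=
    lintegral_mono_set (Icc_subset_Icc hs ht)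
  exact absurd (h2.trans_lt hγ) (by simp [h1])

theorem memLpLoc_of_lintegral_lt_top {g : X → ℝ≥0∞} (hg : AEMeasurable g μ)
    (h : ∫⁻ x, g x ^ p ∂μ < ∞) : MemLpLoc p μ g :=
  ⟨hg, fun _ => ⟨1, one_pos, (setLIntegral_le_lintegral _ _).trans_lt h⟩⟩

variable [BorelSpace X]

theorem RectCurve.aemeasurable (γ : RectCurve X) :
    AEMeasurable γ.toFun (volume.restrict (Icc 0 γ.len)) :=
  γ.continuousOn.aemeasurable measurableSet_Icc

/-- A `μ`-null set is met by `p`-almost every curve in a set of zero length only. -/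
theorem eventually_ae_of_ae (hp : 0 < p) {P : X → Prop} (h : ∀ᵐ x ∂μ, P x) :
    ∀ᶠ γ in aeCurve μ hp, ∀ᵐ t ∂volume.restrict (Icc 0 γ.len), P (γ.toFun t) := by
  obtain ⟨N, hPN, hN, hμN⟩ := exists_measurable_superset_of_null h
  have hm : Measurable (N.indicator fun _ => (∞ : ℝ≥0∞)) := measurable_const.indicator hN
  have h0 : ∫⁻ x, (N.indicator (fun _ => (∞ : ℝ≥0∞)) x) ^ p ∂μ = 0 := by
    rw [lintegral_eq_zero_iff (hm.pow_const _)]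
    filter_upwards [measure_eq_zero_iff_ae_notMem.1 hμN] with x hx
    simp [hx, hp]
  filter_upwards [eventually_lineIntegral_lt_top_of_measurable hp hm (by simp [h0])] with γ hγ
  filter_upwards [ae_lt_top' (hm.comp_aemeasurable γ.aemeasurable) hγ.ne] with t ht
  by_contra hP
  have : γ.toFun t ∈ N := hPN hP
  simp [this] at ht

theorem eventually_aemeasurable (hp : 0 < p) {g : X → ℝ≥0∞} (hg : AEMeasurable g μ) :
    ∀ᶠ γ in aeCurve μ hp,
      AEMeasurable (fun t => g (γ.toFun t)) (volume.restrict (Icc 0 γ.len)) := by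
  filter_upwards [eventually_ae_of_ae hp hg.ae_eq_mk] with γ hγ
  exact (hg.measurable_mk.comp_aemeasurable γ.aemeasurable).congr (EventuallyEq.symm hγ)

theorem eventually_lineIntegral_lt_top (hp : 0 < p) {g : X → ℝ≥0∞} (hg : AEMeasurable g μ)
    (hgp : ∫⁻ x, g x ^ p ∂μ < ∞) : ∀ᶠ γ in aeCurve μ hp, lineIntegral γ g < ∞ := by
  have h1 : ∫⁻ x, hg.mk g x ^ p ∂μ < ∞ := by
    have : (fun x => g x ^ p) =ᵐ[μ] fun x => hg.mk g x ^ p := hg.ae_eq_mk.fun_comp (· ^ p)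
    rwa [lintegral_congr_ae this] at hgp
  filter_upwards [eventually_ae_of_ae hp hg.ae_eq_mk,
    eventually_lineIntegral_lt_top_of_measurable hp hg.measurable_mk h1] with γ hγ hγ'
  rwa [lineIntegral, lintegral_congr_ae hγ]

/-- If balls have positive finite measure, then disjoint families of balls inside a ball are
countable, hence so are maximal separated sets. -/
theorem secondCountableTopology_of_ball
    (hμ : ∀ (x : X) (r : ℝ), 0 < r → 0 < μ (Metric.ball x r) ∧ μ (Metric.ball x r) < ∞) :
    SecondCountableTopology X := by
  rcases isEmpty_or_nonempty X with hX | ⟨⟨x₀⟩⟩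
  · infer_instance
  have : SigmaFinite μ := by
    refine ⟨⟨⟨fun n : ℕ => Metric.ball x₀ (n + 1), fun _ => trivial,
      fun n => (hμ x₀ _ (by positivity)).2, ?_⟩⟩⟩
    refine eq_univ_of_forall fun x => ?_
    obtain ⟨n, hn⟩ := exists_nat_gt (dist x x₀)
    exact mem_iUnion.2 ⟨n, by rw [Metric.mem_ball]; linarith⟩
  refine Metric.secondCountable_of_almost_dense_set fun ε hε => ?_
  obtain ⟨N, hN⟩ := zorn_subset {N : Set X | N.Pairwise fun x y => ε ≤ dist x y} (by
    intro c hc hchain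
    exact ⟨⋃₀ c, (pairwise_sUnion hchain.directedOn).2 fun s hs => hc hs,
      fun s hs => subset_sUnion_of_mem hs⟩)
  refine ⟨N, ?_, fun x => ?_⟩
  · have hd : Pairwise (Function.onFun Disjoint fun x : N => Metric.ball (x : X) (ε / 2)) := by
      intro x y hxy
      refine Metric.ball_disjoint_ball ?_
      have := hN.prop x.2 y.2 (fun h => hxy (Subtype.ext h))
      linarith
    have := Measure.countable_meas_pos_of_disjoint_iUnion (μ := μ)
      (fun x : N => (Metric.isOpen_ball (x := (x : X)) (ε := ε / 2)).measurableSet) hd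
    have huniv : {i : N | 0 < μ (Metric.ball (i : X) (ε / 2))} = univ :=
      eq_univ_of_forall fun x => (hμ x _ (by positivity)).1
    rw [huniv] at this
    exact countable_coe_iff.1 (countable_univ_iff.1 this)
  · by_contra! hx
    have hins : (insert x N).Pairwise fun x y => ε ≤ dist x y := by
      refine hN.prop.insert fun y hy _ => ⟨(hx y hy).le, ?_⟩
      rw [dist_comm]; exact (hx y hy).le
    have hxN : x ∈ N := hN.le_of_ge hins (subset_insert _ _) (mem_insert _ _)
    have := hx x hxN
    simp at this
    linarith

/-- Countably many balls on which `g` is `p`-integrable cover `X`, and the compact image of a curve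
is covered by finitely many of them. -/
theorem MemLpLoc.eventually_lineIntegral_lt_top [SecondCountableTopology X] (hp : 0 < p)
    {g : X → ℝ≥0∞} (hg : MemLpLoc p μ g) : ∀ᶠ γ in aeCurve μ hp, lineIntegral γ g < ∞ := by
  choose r hr hgr using hg.2
  obtain ⟨S, hS, hcov⟩ := TopologicalSpace.countable_cover_nhds
    fun x => Metric.ball_mem_nhds x (hr x)
  have : Countable S := hS.to_subtype
  have h1 : ∀ x : S, ∀ᶠ γ in aeCurve μ hp,
      lineIntegral γ ((Metric.ball (x : X) (r x)).indicator g) < ∞ := by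
    intro x
    refine NewtonianCapacity.eventually_lineIntegral_lt_top hp
      (hg.1.indicator measurableSet_ball) ?_
    convert hgr x using 1
    rw [← lintegral_indicator measurableSet_ball]
    refine lintegral_congr fun y => ?_
    by_cases hy : y ∈ Metric.ball (x : X) (r x) <;> simp [hy, hp]
  filter_upwards [eventually_countable_forall.2 h1, eventually_aemeasurable hp hg.1] with γ hγ hm
  have hK : IsCompact (γ.toFun '' Icc 0 γ.len) := isCompact_Icc.image_of_continuousOn γ.continuousOn
  obtain ⟨F, hF⟩ := hK.elim_finite_subcover (fun x : S => Metric.ball (x : X) (r x))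
    (fun x => Metric.isOpen_ball)
    (by rw [← biUnion_eq_iUnion S fun x _ => Metric.ball x (r x), hcov]; simp)
  calc lineIntegral γ g
      ≤ ∫⁻ t in Icc 0 γ.len,
          ∑ x ∈ F, (Metric.ball (x : X) (r x)).indicator g (γ.toFun t) := by
        refine setLIntegral_mono' measurableSet_Icc fun t ht => ?_
        obtain ⟨x, hx, hxt⟩ := mem_iUnion₂.1 (hF (mem_image_of_mem _ ht))
        refine le_trans ?_ (Finset.single_le_sum (fun _ _ => zero_le) hx)
        rw [indicator_of_mem hxt]
    _ = ∑ x ∈ F, lineIntegral γ ((Metric.ball (x : X) (r x)).indicator g) := by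
        refine lintegral_finsetSum' _ fun x _ => ?_
        refine (hm.indicator₀ (s := {t | γ.toFun t ∈ Metric.ball (x : X) (r x)}) ?_).congr ?_
        · exact γ.aemeasurable.nullMeasurableSet_preimage measurableSet_ball
        · exact Eventually.of_forall fun t => rfl
    _ < ∞ := ENNReal.sum_lt_top.2 fun x _ => hγ x

end Modulus

/-! ### Absolutely continuous functions of one variable -/

section OneVariable

/-- The increments of `f` on `[0, l]` are dominated by the integrals of an integrable function
`φ ≥ 0`: the form in which a function with an upper gradient is seen along a curve. -/
def IncrementsLE (l : ℝ) (f : ℝ → ℝ) (φ : ℝ → ℝ≥0∞) : Prop :=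
  ∀ s t, 0 ≤ s → s ≤ t → t ≤ l → edist (f s) (f t) ≤ ∫⁻ τ in Icc s t, φ τ

variable {l : ℝ} {f : ℝ → ℝ} {φ : ℝ → ℝ≥0∞}

theorem IncrementsLE.dist_le (h : IncrementsLE l f φ)
    (hφ : AEMeasurable φ (volume.restrict (Icc 0 l))) (hfin : ∫⁻ τ in Icc 0 l, φ τ ≠ ∞)
    {s t : ℝ} (hs : 0 ≤ s) (hst : s ≤ t) (ht : t ≤ l) :
    |f t - f s| ≤ ∫ τ in s..t, (φ τ).toReal := by
  have hsub : Icc s t ⊆ Icc 0 l := Icc_subset_Icc hs ht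
  have hfin' : ∫⁻ τ in Icc s t, φ τ ≠ ∞ := ne_top_of_le_ne_top hfin (lintegral_mono_set hsub)
  have hφ' := hφ.mono_measure (Measure.restrict_mono_set volume hsub)
  rw [intervalIntegral.integral_of_le hst, ← integral_Icc_eq_integral_Ioc,
    integral_toReal hφ' (ae_lt_top' hφ' hfin'), ← Real.dist_eq, dist_comm, dist_edist]
  exact ENNReal.toReal_mono hfin' (h s t hs hst ht)

theorem intervalIntegrable_toReal (hl : 0 ≤ l)
    (hφ : AEMeasurable φ (volume.restrict (Icc 0 l))) (hfin : ∫⁻ τ in Icc 0 l, φ τ ≠ ∞) :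
    IntervalIntegrable (fun τ => (φ τ).toReal) volume 0 l := by
  rw [intervalIntegrable_iff_integrableOn_Icc_of_le hl]
  exact integrable_toReal_of_lintegral_ne_top hφ hfin

theorem IncrementsLE.absolutelyContinuousOnInterval (h : IncrementsLE l f φ) (hl : 0 ≤ l)
    (hφ : AEMeasurable φ (volume.restrict (Icc 0 l))) (hfin : ∫⁻ τ in Icc 0 l, φ τ ≠ ∞) :
    AbsolutelyContinuousOnInterval f 0 l := by
  have hI := intervalIntegrable_toReal hl hφ hfin
  have hF := hI.absolutelyContinuousOnInterval_intervalIntegral (c := 0) left_mem_uIcc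
  have hle : ∀ s ∈ uIcc 0 l, ∀ t ∈ uIcc 0 l, dist (f s) (f t) ≤
      dist (∫ τ in (0 : ℝ)..s, (φ τ).toReal) (∫ τ in (0 : ℝ)..t, (φ τ).toReal) := by
    intro s hs t ht
    wlog hst : s ≤ t generalizing s t
    · rw [dist_comm, dist_comm (∫ τ in (0 : ℝ)..s, (φ τ).toReal)]
      exact this t ht s hs (le_of_not_ge hst)
    have hs' := hs
    have ht' := ht
    rw [uIcc_of_le hl] at hs ht
    have h1 := h.dist_le hφ hfin hs.1 hst ht.2
    rw [dist_comm, Real.dist_eq, dist_comm, Real.dist_eq,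
      intervalIntegral.integral_interval_sub_left
        (hI.mono_set (uIcc_subset_uIcc_left ht'))
        (hI.mono_set (uIcc_subset_uIcc_left hs'))]
    exact h1.trans (le_abs_self _)
  refine squeeze_zero' (Eventually.of_forall fun E => Finset.sum_nonneg fun _ _ => dist_nonneg)
    ?_ hF
  refine eventually_inf_principal.2 (Eventually.of_forall fun E hE => ?_)
  exact Finset.sum_le_sum fun i hi => hle _ (hE.1 i hi).1 _ (hE.1 i hi).2

theorem IncrementsLE.ae_enorm_deriv_le (h : IncrementsLE l f φ) (hl : 0 ≤ l)
    (hφ : AEMeasurable φ (volume.restrict (Icc 0 l))) (hfin : ∫⁻ τ in Icc 0 l, φ τ ≠ ∞) :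
    ∀ᵐ t ∂volume.restrict (Icc 0 l), ‖deriv f t‖ₑ ≤ φ t := by
  have hI := intervalIntegrable_toReal hl hφ hfin
  have hac := h.absolutelyContinuousOnInterval hl hφ hfin
  rw [← restrict_Ioo_eq_restrict_Icc] at *
  filter_upwards [ae_restrict_of_ae hac.ae_differentiableAt,
    ae_restrict_of_ae hI.ae_hasDerivAt_integral, ae_restrict_mem measurableSet_Ioo]
    with t h1 h2 ht
  have ht' : t ∈ uIcc 0 l := by rw [uIcc_of_le hl]; exact Ioo_subset_Icc_self ht
  have hf := (h1 ht').hasDerivAt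
  have hF := h2 ht' 0 left_mem_uIcc
  have key : |deriv f t| ≤ (φ t).toReal := by
    -- Compare the right difference quotients of `f` with those of the primitive of `φ`.
    have e1 := (hf.tendsto_slope.mono_left
      (nhdsWithin_mono t (fun x (hx : t < x) => hx.ne') : 𝓝[>] t ≤ 𝓝[≠] t)).abs
    have e2 := hF.tendsto_slope.mono_left
      (nhdsWithin_mono t (fun x (hx : t < x) => hx.ne') : 𝓝[>] t ≤ 𝓝[≠] t)
    refine le_of_tendsto_of_tendsto e1 e2 ?_
    filter_upwards [Ioo_mem_nhdsGT ht.2] with y hy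
    have hy' : y ∈ uIcc 0 l := by rw [uIcc_of_le hl]; exact ⟨ht.1.le.trans hy.1.le, hy.2.le⟩
    rw [slope_def_field, slope_def_field, abs_div, abs_of_pos (sub_pos.2 hy.1),
      intervalIntegral.integral_interval_sub_left
        (hI.mono_set (uIcc_subset_uIcc_left hy'))
        (hI.mono_set (uIcc_subset_uIcc_left ht'))]
    have := sub_pos.2 hy.1
    gcongr
    exact h.dist_le (by rwa [← restrict_Ioo_eq_restrict_Icc])
      (by rwa [← restrict_Ioo_eq_restrict_Icc]) ht.1.le hy.1.le hy.2.le
  rw [Real.enorm_eq_ofReal_abs]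
  exact ENNReal.ofReal_le_of_le_toReal key

theorem edist_le_lintegral_enorm_deriv (hl : 0 ≤ l)
    (h : AbsolutelyContinuousOnInterval f 0 l) :
    edist (f 0) (f l) ≤ ∫⁻ τ in Icc 0 l, ‖deriv f τ‖ₑ := by
  rw [edist_comm, edist_eq_enorm_sub, ← h.integral_deriv_eq_sub,
    intervalIntegral.integral_of_le hl, ← integral_Icc_eq_integral_Ioc]
  exact enorm_integral_le_lintegral_enorm _

/-- At a point where `f`, `g` and `max f g` are all differentiable, the derivative of `max f g` is
that of the larger function; at a point where `f = g`, the function `max f g - g` has a minimum. -/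
theorem deriv_max_eq {f g : ℝ → ℝ} {t : ℝ} (hf : DifferentiableAt ℝ f t)
    (hg : DifferentiableAt ℝ g t) (hm : DifferentiableAt ℝ (fun x => max (f x) (g x)) t) :
    deriv (fun x => max (f x) (g x)) t = if g t < f t then deriv f t else deriv g t := by
  split_ifs with hlt
  · refine EventuallyEq.deriv_eq ?_
    filter_upwards [hg.continuousAt.eventually_lt hf.continuousAt hlt] with x hx
    exact max_eq_left hx.le
  · have hmin : IsLocalMin (fun x => max (f x) (g x) - g x) t := by
      refine Eventually.of_forall fun x => ?_
      simp only [max_eq_right (not_lt.1 hlt), sub_self]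
      exact sub_nonneg.2 (le_max_right _ _)
    have := hmin.deriv_eq_zero
    rw [deriv_fun_sub hm hg] at this
    linarith

theorem deriv_min_eq {f g : ℝ → ℝ} {t : ℝ} (hf : DifferentiableAt ℝ f t)
    (hg : DifferentiableAt ℝ g t) (hm : DifferentiableAt ℝ (fun x => min (f x) (g x)) t) :
    deriv (fun x => min (f x) (g x)) t = if g t < f t then deriv g t else deriv f t := by
  have h1 : (fun x => min (f x) (g x)) = fun x => -max (-g x) (-f x) := by
    ext x; simp [max_neg_neg, min_comm]
  have h2 : DifferentiableAt ℝ (fun x => max (-g x) (-f x)) t := by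
    have : (fun x => max (-g x) (-f x)) = fun x => -min (f x) (g x) := by
      ext x; simp [max_neg_neg, min_comm]
    rw [this]; exact hm.neg
  rw [h1, deriv.fun_neg,
    deriv_max_eq (f := fun x => -g x) (g := fun x => -f x) hg.fun_neg hf.fun_neg h2]
  simp only [neg_lt_neg_iff, deriv.fun_neg]
  split_ifs <;> simp

theorem ae_restrict_differentiableAt (hl : 0 ≤ l)
    (h : AbsolutelyContinuousOnInterval f 0 l) :
    ∀ᵐ t ∂volume.restrict (Icc 0 l), DifferentiableAt ℝ f t := by
  rw [ae_restrict_iff' measurableSet_Icc]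
  simpa [uIcc_of_le hl] using h.ae_differentiableAt

end OneVariable

/-! ### Weak upper gradients of real-valued functions -/

theorem edist_max_max_le (a b c d : ℝ) :
    edist (max a b) (max c d) ≤ edist a c + edist b d := by
  simp only [edist_dist, Real.dist_eq]
  rw [← ENNReal.ofReal_add (abs_nonneg _) (abs_nonneg _)]
  exact ENNReal.ofReal_le_ofReal ((abs_max_sub_max_le_max a b c d).trans
    (max_le_add_of_nonneg (abs_nonneg _) (abs_nonneg _)))

theorem edist_min_min_le (a b c d : ℝ) :
    edist (min a b) (min c d) ≤ edist a c + edist b d := by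
  simp only [edist_dist, Real.dist_eq]
  rw [← ENNReal.ofReal_add (abs_nonneg _) (abs_nonneg _)]
  exact ENNReal.ofReal_le_ofReal ((abs_min_sub_min_le_max a b c d).trans
    (max_le_add_of_nonneg (abs_nonneg _) (abs_nonneg _)))

theorem aemeasurable_ite_lt {α : Type*} [MeasurableSpace α] {μ : Measure α} {v w : α → ℝ}
    {g h : α → ℝ≥0∞} (hv : AEMeasurable v μ) (hw : AEMeasurable w μ)
    (hg : AEMeasurable g μ) (hh : AEMeasurable h μ) :
    AEMeasurable (fun x => if w x < v x then g x else h x) μ := by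
  have hs : NullMeasurableSet {x | w x < v x} μ := nullMeasurableSet_lt hw hv
  refine ((hg.indicator₀ hs).add (hh.indicator₀ hs.compl)).congr (Eventually.of_forall fun x => ?_)
  by_cases hx : w x < v x <;> simp [hx, indicator]

section WeakUpperGradient

variable {X : Type*} [MetricSpace X] [MeasurableSpace X] [BorelSpace X] {p : ℝ} {μ : Measure X}
  {v w : X → ℝ} {g h : X → ℝ≥0∞}

/-- The measurability along curves that is part of the definition of a weak upper gradient holds
automatically. -/
theorem isWeakUpperGradient_coe_iff (hp : 0 < p) :
    IsWeakUpperGradient p μ (fun x => (v x : EReal)) g ↔ AEMeasurable g μ ∧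
      ∀ᶠ γ in aeCurve μ hp, edist (v (γ.toFun 0)) (v (γ.toFun γ.len)) ≤ lineIntegral γ g := by
  refine and_congr_right fun hg => ?_
  rw [← eventually_aeCurve (hp := hp)]
  simp only [ugInequality_coe_iff]
  exact ⟨fun H => H.mono fun γ h => h.2, fun H => (eventually_aemeasurable hp hg).and H⟩

theorem eventually_incrementsLE (hp : 0 < p)
    (hg : IsWeakUpperGradient p μ (fun x => (v x : EReal)) g) :
    ∀ᶠ γ in aeCurve μ hp,
      IncrementsLE γ.len (fun t => v (γ.toFun t)) (fun t => g (γ.toFun t)) := by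
  filter_upwards [eventually_subcurve ((isWeakUpperGradient_coe_iff hp).1 hg).2]
    with γ hγ s t hs hst ht
  rcases hst.eq_or_lt with rfl | hst
  · simp
  · have := hγ s t hs hst ht
    rw [lineIntegral_subcurve] at this
    simpa [RectCurve.subcurve] using this

/-- A function that is absolutely continuous along almost every curve has every bound for its
derivatives along curves as a weak upper gradient. -/
theorem isWeakUpperGradient_of_deriv (hp : 0 < p) (hh : AEMeasurable h μ)
    (H : ∀ᶠ γ in aeCurve μ hp,
      AbsolutelyContinuousOnInterval (fun t => v (γ.toFun t)) 0 γ.len ∧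
      ∀ᵐ t ∂volume.restrict (Icc 0 γ.len),
        ‖deriv (fun t => v (γ.toFun t)) t‖ₑ ≤ h (γ.toFun t)) :
    IsWeakUpperGradient p μ (fun x => (v x : EReal)) h := by
  refine (isWeakUpperGradient_coe_iff hp).2 ⟨hh, H.mono fun γ hγ => ?_⟩
  exact (edist_le_lintegral_enorm_deriv γ.len_pos.le hγ.1).trans
    (lintegral_mono_ae hγ.2)

theorem eventually_absolutelyContinuous (hp : 0 < p)
    (hg : IsWeakUpperGradient p μ (fun x => (v x : EReal)) g)
    (hfin : ∀ᶠ γ in aeCurve μ hp, lineIntegral γ g < ∞) :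
    ∀ᶠ γ in aeCurve μ hp,
      AbsolutelyContinuousOnInterval (fun t => v (γ.toFun t)) 0 γ.len ∧
      ∀ᵐ t ∂volume.restrict (Icc 0 γ.len),
        ‖deriv (fun t => v (γ.toFun t)) t‖ₑ ≤ g (γ.toFun t) := by
  filter_upwards [eventually_incrementsLE hp hg, hfin, eventually_aemeasurable hp hg.1]
    with γ h1 h2 h3
  exact ⟨h1.absolutelyContinuousOnInterval γ.len_pos.le h3 h2.ne,
    h1.ae_enorm_deriv_le γ.len_pos.le h3 h2.ne⟩

theorem isWeakUpperGradient_iInf {ι : Type*} [Countable ι] [Nonempty ι] (hp : 0 < p)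
    {g : ι → X → ℝ≥0∞} (hg : ∀ i, IsWeakUpperGradient p μ (fun x => (v x : EReal)) (g i))
    (hfin : ∀ i, ∀ᶠ γ in aeCurve μ hp, lineIntegral γ (g i) < ∞) :
    IsWeakUpperGradient p μ (fun x => (v x : EReal)) (fun x => ⨅ i, g i x) := by
  refine isWeakUpperGradient_of_deriv hp (.iInf fun i => (hg i).1) ?_
  filter_upwards [eventually_countable_forall.2
    fun i => eventually_absolutelyContinuous hp (hg i) (hfin i)] with γ hγ
  refine ⟨(hγ (Classical.arbitrary ι)).1, ?_⟩
  filter_upwards [ae_all_iff.2 fun i => (hγ i).2] with t ht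
  exact le_iInf ht

/-- Along almost every curve, at almost every time, `max v w` has the same derivative as the larger
of `v` and `w`. -/
theorem isWeakUpperGradient_max (hp : 0 < p) (hv : AEMeasurable v μ) (hw : AEMeasurable w μ)
    (hg : IsWeakUpperGradient p μ (fun x => (v x : EReal)) g)
    (hh : IsWeakUpperGradient p μ (fun x => (w x : EReal)) h)
    (hgfin : ∀ᶠ γ in aeCurve μ hp, lineIntegral γ g < ∞)
    (hhfin : ∀ᶠ γ in aeCurve μ hp, lineIntegral γ h < ∞) :
    IsWeakUpperGradient p μ (fun x => ((max (v x) (w x) : ℝ) : EReal))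
      (fun x => if w x < v x then g x else h x) := by
  refine isWeakUpperGradient_of_deriv hp (aemeasurable_ite_lt hv hw hg.1 hh.1) ?_
  filter_upwards [eventually_incrementsLE hp hg, eventually_incrementsLE hp hh, hgfin, hhfin,
    eventually_aemeasurable hp hg.1, eventually_aemeasurable hp hh.1,
    eventually_absolutelyContinuous hp hg hgfin, eventually_absolutelyContinuous hp hh hhfin]
    with γ ig ih fg fh mg mh ag ah
  have inc : IncrementsLE γ.len (fun t => max (v (γ.toFun t)) (w (γ.toFun t)))
      (fun t => g (γ.toFun t) + h (γ.toFun t)) := fun s t hs hst ht =>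
    (edist_max_max_le _ _ _ _).trans
      ((add_le_add (ig s t hs hst ht) (ih s t hs hst ht)).trans (le_lintegral_add _ _))
  have ac := inc.absolutelyContinuousOnInterval γ.len_pos.le (mg.add mh)
    (by rw [lintegral_add_left' mg]; exact (ENNReal.add_lt_top.2 ⟨fg, fh⟩).ne)
  refine ⟨ac, ?_⟩
  have hl := γ.len_pos.le
  filter_upwards [ae_restrict_differentiableAt hl ac,
    ae_restrict_differentiableAt hl ag.1,
    ae_restrict_differentiableAt hl ah.1, ag.2, ah.2]
    with t d1 d2 d3 e1 e2
  rw [deriv_max_eq d2 d3 d1]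
  split_ifs <;> assumption

theorem isWeakUpperGradient_min (hp : 0 < p) (hv : AEMeasurable v μ) (hw : AEMeasurable w μ)
    (hg : IsWeakUpperGradient p μ (fun x => (v x : EReal)) g)
    (hh : IsWeakUpperGradient p μ (fun x => (w x : EReal)) h)
    (hgfin : ∀ᶠ γ in aeCurve μ hp, lineIntegral γ g < ∞)
    (hhfin : ∀ᶠ γ in aeCurve μ hp, lineIntegral γ h < ∞) :
    IsWeakUpperGradient p μ (fun x => ((min (v x) (w x) : ℝ) : EReal))
      (fun x => if w x < v x then h x else g x) := by
  refine isWeakUpperGradient_of_deriv hp (aemeasurable_ite_lt hv hw hh.1 hg.1) ?_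
  filter_upwards [eventually_incrementsLE hp hg, eventually_incrementsLE hp hh, hgfin, hhfin,
    eventually_aemeasurable hp hg.1, eventually_aemeasurable hp hh.1,
    eventually_absolutelyContinuous hp hg hgfin, eventually_absolutelyContinuous hp hh hhfin]
    with γ ig ih fg fh mg mh ag ah
  have inc : IncrementsLE γ.len (fun t => min (v (γ.toFun t)) (w (γ.toFun t)))
      (fun t => g (γ.toFun t) + h (γ.toFun t)) := fun s t hs hst ht =>
    (edist_min_min_le _ _ _ _).trans
      ((add_le_add (ig s t hs hst ht) (ih s t hs hst ht)).trans (le_lintegral_add _ _))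
  have ac := inc.absolutelyContinuousOnInterval γ.len_pos.le (mg.add mh)
    (by rw [lintegral_add_left' mg]; exact (ENNReal.add_lt_top.2 ⟨fg, fh⟩).ne)
  refine ⟨ac, ?_⟩
  have hl := γ.len_pos.le
  filter_upwards [ae_restrict_differentiableAt hl ac,
    ae_restrict_differentiableAt hl ag.1,
    ae_restrict_differentiableAt hl ah.1, ag.2, ah.2]
    with t d1 d2 d3 e1 e2
  rw [deriv_min_eq d2 d3 d1]
  split_ifs <;> assumption

/-! ### Minimal weak upper gradients -/

/-- The infimum of a minimizing sequence for `∫ g ^ p` is a minimal weak upper gradient: by the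
lattice property its minimum with any competitor is again a weak upper gradient, and cannot have
smaller energy. -/
theorem exists_isMinimalWeakUpperGradient [SecondCountableTopology X] (hp : 0 < p)
    (hg : IsWeakUpperGradient p μ (fun x => (v x : EReal)) g) (hgp : ∫⁻ x, g x ^ p ∂μ < ∞) :
    ∃ g₀, IsMinimalWeakUpperGradient p μ (fun x => (v x : EReal)) g₀ ∧
      ∫⁻ x, g₀ x ^ p ∂μ ≤ ∫⁻ x, g x ^ p ∂μ := by
  let S : Set ℝ≥0∞ := {I | I < ∞ ∧ ∃ g : X → ℝ≥0∞,
    IsWeakUpperGradient p μ (fun x => (v x : EReal)) g ∧ ∫⁻ x, g x ^ p ∂μ = I}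
  have hS : S.Nonempty := ⟨_, hgp, g, hg, rfl⟩
  obtain ⟨u, -, hu, huS⟩ := exists_seq_tendsto_sInf hS (OrderBot.bddBelow S)
  choose hfin G hG hGu using huS
  let g₀ : X → ℝ≥0∞ := fun x => ⨅ n, G n x
  have hg₀ : IsWeakUpperGradient p μ (fun x => (v x : EReal)) g₀ :=
    isWeakUpperGradient_iInf hp hG fun n =>
      eventually_lineIntegral_lt_top hp (hG n).1 ((hGu n).trans_lt (hfin n))
  have hle : ∫⁻ x, g₀ x ^ p ∂μ ≤ sInf S := by
    refine ge_of_tendsto' hu fun n => ?_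
    rw [← hGu n]
    exact lintegral_mono fun x => ENNReal.rpow_le_rpow (iInf_le _ n) hp.le
  have hinf : sInf S ≤ ∫⁻ x, g x ^ p ∂μ := sInf_le (show _ ∈ S from ⟨hgp, g, hg, rfl⟩)
  have hfin₀ : ∫⁻ x, g₀ x ^ p ∂μ < ∞ := hle.trans_lt (hinf.trans_lt hgp)
  refine ⟨g₀, ⟨hg₀, memLpLoc_of_lintegral_lt_top hg₀.1 hfin₀, fun g' hg' hg'loc => ?_⟩,
    hle.trans hinf⟩
  -- The minimum of `g₀` and `g'`, as a countable infimum.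
  let G' : Bool → X → ℝ≥0∞ := fun b => cond b g₀ g'
  have hmin : IsWeakUpperGradient p μ (fun x => (v x : EReal)) (fun x => ⨅ b, G' b x) := by
    refine isWeakUpperGradient_iInf hp (fun b => ?_) (fun b => ?_)
    · cases b <;> assumption
    · cases b
      · exact hg'loc.eventually_lineIntegral_lt_top hp
      · exact eventually_lineIntegral_lt_top hp hg₀.1 hfin₀
  have hle₀ : ∀ x, ⨅ b, G' b x ≤ g₀ x := fun x => iInf_le (fun b => G' b x) true
  have hpow : ∀ x, (⨅ b, G' b x) ^ p ≤ g₀ x ^ p := fun x => ENNReal.rpow_le_rpow (hle₀ x) hp.le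
  have hint := lintegral_mono (μ := μ) hpow
  have hae := ae_eq_of_ae_le_of_lintegral_le (Eventually.of_forall hpow)
    (hint.trans_lt hfin₀).ne (hg₀.1.pow_const p)
    (hle.trans (sInf_le (show _ ∈ S from ⟨hint.trans_lt hfin₀, _, hmin, rfl⟩)))
  filter_upwards [hae] with x hx
  calc g₀ x = ⨅ b, G' b x := ((ENNReal.rpow_left_injective hp.ne') hx).symm
    _ ≤ g' x := iInf_le (fun b => G' b x) false

end WeakUpperGradient

/-! ### Admissible functions for the capacity -/

/-- The truncation of an extended real number to `[0, 1]`, as a real number; `±∞` becomes `1` or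
`0`. -/
noncomputable def truncation (a : EReal) : ℝ := (max 0 (min a 1)).toReal

theorem truncation_coe (a : ℝ) : truncation (a : EReal) = max 0 (min a 1) := by
  have : (max 0 (min (a : EReal) 1)) = ((max 0 (min a 1) : ℝ) : EReal) := by
    rfl
  rw [truncation, this, EReal.toReal_coe]

theorem edist_truncation_le (a b : EReal) :
    edist (truncation a) (truncation b) ≤ (a - b).abs := by
  by_cases h : a = ⊤ ∨ a = ⊥ ∨ b = ⊤ ∨ b = ⊥
  · simp [abs_sub_eq_top a b h]
  · push Not at h
    lift a to ℝ using ⟨h.1, h.2.1⟩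
    lift b to ℝ using ⟨h.2.2.1, h.2.2.2⟩
    rw [truncation_coe, truncation_coe, ← EReal.coe_sub, EReal.abs_def, edist_dist, Real.dist_eq]
    refine ENNReal.ofReal_le_ofReal ?_
    refine (abs_max_sub_max_le_max _ _ _ _).trans (max_le (by simp) ?_)
    exact (abs_min_sub_min_le_max _ _ _ _).trans (by simp)

theorem coe_truncation (a : EReal) : (truncation a : EReal) = max 0 (min a 1) := by
  refine EReal.coe_toReal (ne_of_lt ?_) (ne_of_gt ?_)
  · exact max_lt (by simp) ((min_le_right _ _).trans_lt (by exact_mod_cast EReal.coe_lt_top 1))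
  · exact lt_of_lt_of_le (by simp) (le_max_left _ _)

theorem truncation_mem (a : EReal) : truncation a ∈ Icc (0 : ℝ) 1 := by
  constructor
  · rw [← EReal.coe_le_coe_iff, coe_truncation]; exact le_max_left _ _
  · rw [← EReal.coe_le_coe_iff, coe_truncation]; simp

theorem one_le_truncation {a : EReal} (h : 1 ≤ a) : 1 ≤ truncation a := by
  rw [← EReal.coe_le_coe_iff, coe_truncation]; simp [h]

theorem measurable_truncation : Measurable truncation :=
  measurable_ereal_toReal.comp (measurable_const.max (measurable_id.min measurable_const))

/-- A supremum of functions, each with increment at most `D`, has increment at most `D`. -/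
theorem edist_ciSup_ciSup_le {ι : Type*} [Nonempty ι] {a b : ι → ℝ} (ha : BddAbove (range a))
    (hb : BddAbove (range b)) {D : ℝ≥0∞} (h : ∀ i, edist (a i) (b i) ≤ D) :
    edist (⨆ i, a i) (⨆ i, b i) ≤ D := by
  rcases eq_or_ne D ∞ with rfl | hD
  · exact le_top
  have h' : ∀ i, |a i - b i| ≤ D.toReal := fun i => by
    rw [← Real.dist_eq, dist_edist]; exact ENNReal.toReal_mono hD (h i)
  rw [edist_dist]
  refine ENNReal.ofReal_le_of_le_toReal ?_
  rw [Real.dist_eq, abs_sub_le_iff, sub_le_iff_le_add, sub_le_iff_le_add]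
  constructor
  · refine ciSup_le fun i => ?_
    have := le_ciSup hb i
    linarith [(abs_le.1 (h' i)).2]
  · refine ciSup_le fun i => ?_
    have := le_ciSup ha i
    linarith [(abs_le.1 (h' i)).1]

section Capacity

variable {X : Type*} [MetricSpace X] [MeasurableSpace X] {p : ℝ} {μ : Measure X}
  {A A₁ A₂ E : Set X} {v v₁ v₂ : X → ℝ} {g g₁ g₂ : X → ℝ≥0∞}

/-- `v` is a real-valued competitor for `cap_p(A, E)` with values in `[0, 1]`, and `g` is a
`p`-weak upper gradient of it. -/
structure Admissible (p : ℝ) (μ : Measure X) (A E : Set X) (v : X → ℝ) (g : X → ℝ≥0∞) :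
    Prop where
  aemeasurable : AEMeasurable v μ
  mem_Icc : ∀ x, v x ∈ Icc (0 : ℝ) 1
  one_le : ∀ x ∈ A, 1 ≤ v x
  eq_zero : ∀ x ∉ E, v x = 0
  isWeakUpperGradient : IsWeakUpperGradient p μ (fun x => (v x : EReal)) g

theorem Admissible.mono (h : Admissible p μ A₂ E v g) (hA : A₁ ⊆ A₂) : Admissible p μ A₁ E v g :=
  { h with one_le := fun x hx => h.one_le x (hA hx) }

/-- Truncation does not increase upper gradients, so real-valued competitors suffice. -/
theorem exists_admissible_of_varCap_lt {c : ℝ≥0∞} (h : varCap p μ A E < c) :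
    ∃ v g, Admissible p μ A E v g ∧ ∫⁻ x, g x ^ p ∂μ < c := by
  simp only [varCap, energy, iInf_lt_iff] at h
  obtain ⟨u, hu, huA, g, hg, hgc⟩ := h
  refine ⟨fun x => truncation (u x), g, ⟨measurable_truncation.comp_aemeasurable hu.1.1,
    fun x => truncation_mem _, fun x hx => one_le_truncation (huA x hx), fun x hx => ?_,
    hg.1.1, hg.1.2.mono ?_⟩, hgc⟩
  · rw [hu.2 x hx, ← EReal.coe_zero, truncation_coe]; simp
  · refine fun γ hγ H => hγ ⟨H.1, ugInequality_coe_iff.2 ?_⟩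
    exact (edist_truncation_le _ _).trans H.2

theorem varCap_mono (hA : A₁ ⊆ A₂) : varCap p μ A₁ E ≤ varCap p μ A₂ E :=
  iInf₂_mono fun _ _ => le_iInf fun h => iInf_le _ fun x hx => h x (hA hx)

theorem varCap_anti {E₁ E₂ : Set X} (hE : E₁ ⊆ E₂) : varCap p μ A E₂ ≤ varCap p μ A E₁ :=
  le_iInf₂ fun u hu => iInf₂_le u ⟨hu.1, fun x hx => hu.2 x fun hx' => hx (hE hx')⟩

variable [BorelSpace X]

/-- Adding a test function for the exceptional family turns a weak upper gradient into an upper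
gradient; here the maximum takes the place of the sum. -/
theorem exists_isUpperGradient (hp : 0 < p)
    (hg : IsWeakUpperGradient p μ (fun x => (v x : EReal)) g) (hgp : ∫⁻ x, g x ^ p ∂μ < ∞) :
    ∃ G, IsUpperGradient (fun x => (v x : EReal)) G ∧ MemLpLoc p μ G := by
  have H : ∀ᶠ γ in aeCurve μ hp,
      edist (v (γ.toFun 0)) (v (γ.toFun γ.len)) ≤ lineIntegral γ (hg.1.mk g) := by
    filter_upwards [((isWeakUpperGradient_coe_iff hp).1 hg).2,
      eventually_ae_of_ae hp hg.1.ae_eq_mk] with γ h1 h2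
    rwa [lineIntegral, ← lintegral_congr_ae h2]
  obtain ⟨ρ, hρm, hρ, hΓ⟩ := eventually_aeCurve.1 H
  have hm : Measurable fun x => max (hg.1.mk g x) (ρ x) := hg.1.measurable_mk.max hρm
  refine ⟨_, ⟨hm, fun γ => ugInequality_coe_iff.2 ?_⟩,
    memLpLoc_of_lintegral_lt_top hm.aemeasurable ?_⟩
  · by_cases hγ : edist (v (γ.toFun 0)) (v (γ.toFun γ.len)) ≤ lineIntegral γ (hg.1.mk g)
    · exact hγ.trans (lineIntegral_mono γ fun x => le_max_left _ _)
    · refine le_trans le_top ((hΓ γ hγ).ge.trans (lineIntegral_mono γ fun x => le_max_right _ _))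
  · have h1 : ∫⁻ x, hg.1.mk g x ^ p ∂μ < ∞ := by
      have : (fun x => g x ^ p) =ᵐ[μ] fun x => hg.1.mk g x ^ p :=
        hg.1.ae_eq_mk.fun_comp (· ^ p)
      rwa [lintegral_congr_ae this] at hgp
    calc ∫⁻ x, max (hg.1.mk g x) (ρ x) ^ p ∂μ
        ≤ ∫⁻ x, (hg.1.mk g x ^ p + ρ x ^ p) ∂μ := by
          refine lintegral_mono fun x => ?_
          rw [(ENNReal.monotone_rpow_of_nonneg hp.le).map_max]
          exact max_le le_self_add le_add_self
      _ = ∫⁻ x, hg.1.mk g x ^ p ∂μ + ∫⁻ x, ρ x ^ p ∂μ :=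
          lintegral_add_right _ (hρm.pow_const _)
      _ < ∞ := ENNReal.add_lt_top.2 ⟨h1, hρ⟩

theorem Admissible.varCap_le [SecondCountableTopology X] (hp : 0 < p) (hE : μ E < ∞)
    (h : Admissible p μ A E v g) : varCap p μ A E ≤ ∫⁻ x, g x ^ p ∂μ := by
  rcases eq_or_ne (∫⁻ x, g x ^ p ∂μ) ∞ with htop | hfin
  · simp [htop]
  obtain ⟨g₀, hg₀, hle⟩ :=
    exists_isMinimalWeakUpperGradient hp h.isWeakUpperGradient hfin.lt_top
  have hen := energy_eq hg₀
  have hmem : (fun x => (v x : EReal)) ∈ newtonianSpaceZero p μ E := by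
    refine ⟨⟨measurable_coe_real_ereal.comp_aemeasurable h.aemeasurable,
      exists_isUpperGradient hp h.isWeakUpperGradient hfin.lt_top, ?_⟩,
      fun x hx => by simp [h.eq_zero x hx]⟩
    refine ENNReal.rpow_lt_top_of_nonneg (by positivity) (ENNReal.add_lt_top.2 ⟨?_, ?_⟩).ne
    · calc ∫⁻ x, (v x : EReal).abs ^ p ∂μ
          ≤ ∫⁻ x, (toMeasurable μ E).indicator 1 x ∂μ := by
            refine lintegral_mono fun x => ?_
            by_cases hx : x ∈ toMeasurable μ E
            · rw [indicator_of_mem hx, EReal.abs_def, abs_of_nonneg (h.mem_Icc x).1]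
              refine ENNReal.rpow_le_one ?_ hp.le
              exact ENNReal.ofReal_le_one.2 (h.mem_Icc x).2
            · simp [h.eq_zero x fun hxE => hx (subset_toMeasurable μ E hxE), hp]
        _ = μ E := by
            rw [lintegral_indicator_one (measurableSet_toMeasurable μ E), measure_toMeasurable]
        _ < ∞ := hE
    · rw [hen]; exact hle.trans_lt hfin.lt_top
  calc varCap p μ A E ≤ energy p μ (fun x => (v x : EReal)) :=
        iInf₂_le_of_le _ hmem (iInf_le _ fun x hx => EReal.coe_le_coe_iff.2 (h.one_le x hx))
    _ ≤ _ := hen.trans_le hle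

/-! ### Elementary properties of the capacity -/

theorem varCap_empty [SecondCountableTopology X] (hp : 0 < p) (hE : μ E < ∞) :
    varCap p μ ∅ E = 0 := by
  have h : Admissible p μ ∅ E (fun _ => 0) (fun _ => 0) :=
    ⟨aemeasurable_const, fun _ => by simp, by simp, fun _ _ => rfl,
      (isWeakUpperGradient_coe_iff hp).2
        ⟨aemeasurable_const, Eventually.of_forall fun γ => by simp⟩⟩
  simpa [hp] using h.varCap_le hp hE

/-- The energies of `max v₁ v₂` and `min v₁ v₂` add up to at most those of `v₁` and `v₂`, because
the two gradients are only redistributed between the sets `{v₂ < v₁}` and `{v₁ ≤ v₂}`. -/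
theorem varCap_union_add_varCap_inter_le [SecondCountableTopology X] (hp : 0 < p) (hE : μ E < ∞) :
    varCap p μ (A₁ ∪ A₂) E + varCap p μ (A₁ ∩ A₂) E ≤ varCap p μ A₁ E + varCap p μ A₂ E := by
  refine ENNReal.le_of_forall_pos_le_add fun ε hε hfin => ?_
  have hε2 : (ε / 2 : ℝ≥0∞) ≠ 0 := by simpa using hε.ne'
  obtain ⟨hf1, hf2⟩ := ENNReal.add_lt_top.1 hfin
  obtain ⟨v₁, g₁, h₁, hl₁⟩ := exists_admissible_of_varCap_lt (ENNReal.lt_add_right hf1.ne hε2)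
  obtain ⟨v₂, g₂, h₂, hl₂⟩ := exists_admissible_of_varCap_lt (ENNReal.lt_add_right hf2.ne hε2)
  have hεtop : (ε / 2 : ℝ≥0∞) < ∞ := ENNReal.div_lt_top ENNReal.coe_ne_top (by simp)
  have c₁ := eventually_lineIntegral_lt_top hp h₁.isWeakUpperGradient.1
    (hl₁.trans (ENNReal.add_lt_top.2 ⟨hf1, hεtop⟩))
  have c₂ := eventually_lineIntegral_lt_top hp h₂.isWeakUpperGradient.1
    (hl₂.trans (ENNReal.add_lt_top.2 ⟨hf2, hεtop⟩))
  have hmax : Admissible p μ (A₁ ∪ A₂) E (fun x => max (v₁ x) (v₂ x))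
      (fun x => if v₂ x < v₁ x then g₁ x else g₂ x) :=
    ⟨h₁.aemeasurable.max h₂.aemeasurable,
      fun x => ⟨le_max_of_le_left (h₁.mem_Icc x).1, max_le (h₁.mem_Icc x).2 (h₂.mem_Icc x).2⟩,
      fun x hx => hx.elim (fun hx => le_max_of_le_left (h₁.one_le x hx))
        (fun hx => le_max_of_le_right (h₂.one_le x hx)),
      fun x hx => by simp [h₁.eq_zero x hx, h₂.eq_zero x hx],
      isWeakUpperGradient_max hp h₁.aemeasurable h₂.aemeasurable h₁.isWeakUpperGradient
        h₂.isWeakUpperGradient c₁ c₂⟩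
  have hmin : Admissible p μ (A₁ ∩ A₂) E (fun x => min (v₁ x) (v₂ x))
      (fun x => if v₂ x < v₁ x then g₂ x else g₁ x) :=
    ⟨h₁.aemeasurable.min h₂.aemeasurable,
      fun x => ⟨le_min (h₁.mem_Icc x).1 (h₂.mem_Icc x).1, min_le_of_left_le (h₁.mem_Icc x).2⟩,
      fun x hx => le_min (h₁.one_le x hx.1) (h₂.one_le x hx.2),
      fun x hx => by simp [h₁.eq_zero x hx, h₂.eq_zero x hx],
      isWeakUpperGradient_min hp h₁.aemeasurable h₂.aemeasurable h₁.isWeakUpperGradient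
        h₂.isWeakUpperGradient c₁ c₂⟩
  calc varCap p μ (A₁ ∪ A₂) E + varCap p μ (A₁ ∩ A₂) E
      ≤ ∫⁻ x, (if v₂ x < v₁ x then g₁ x else g₂ x) ^ p ∂μ +
          ∫⁻ x, (if v₂ x < v₁ x then g₂ x else g₁ x) ^ p ∂μ :=
        add_le_add (hmax.varCap_le hp hE) (hmin.varCap_le hp hE)
    _ = ∫⁻ x, g₁ x ^ p ∂μ + ∫⁻ x, g₂ x ^ p ∂μ := by
        rw [← lintegral_add_left' (hmax.isWeakUpperGradient.1.pow_const p),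
          ← lintegral_add_left' (h₁.isWeakUpperGradient.1.pow_const p)]
        refine lintegral_congr fun x => ?_
        split_ifs
        · rfl
        · exact add_comm _ _
    _ ≤ (varCap p μ A₁ E + ε / 2) + (varCap p μ A₂ E + ε / 2) := add_le_add hl₁.le hl₂.le
    _ = varCap p μ A₁ E + varCap p μ A₂ E + ε := by
        rw [add_add_add_comm, ENNReal.add_halves]

theorem varCap_iUnion_le [SecondCountableTopology X] (hp : 0 < p) (hE : μ E < ∞)
    (A : ℕ → Set X) : varCap p μ (⋃ i, A i) E ≤ ∑' i, varCap p μ (A i) E := by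
  refine ENNReal.le_of_forall_pos_le_add fun ε hε hfin => ?_
  obtain ⟨δ, hδ, hsum⟩ := ENNReal.exists_pos_sum_of_countable'
    (ENNReal.coe_ne_zero.2 hε.ne') ℕ
  have hlt : ∀ i, varCap p μ (A i) E < varCap p μ (A i) E + δ i := fun i =>
    ENNReal.lt_add_right (ENNReal.ne_top_of_tsum_ne_top hfin.ne i) (hδ i).ne'
  choose v g h hl using fun i => exists_admissible_of_varCap_lt (hlt i)
  have hbdd : ∀ x, BddAbove (range fun i => v i x) := fun x =>
    ⟨1, forall_mem_range.2 fun i => ((h i).mem_Icc x).2⟩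
  have hsup : Admissible p μ (⋃ i, A i) E (fun x => ⨆ i, v i x) (fun x => ⨆ i, g i x) := by
    refine ⟨.iSup fun i => (h i).aemeasurable,
      fun x => ⟨((h 0).mem_Icc x).1.trans (le_ciSup (hbdd x) 0),
        ciSup_le fun i => ((h i).mem_Icc x).2⟩, fun x hx => ?_, fun x hx => ?_, ?_⟩
    · obtain ⟨i, hi⟩ := mem_iUnion.1 hx
      exact ((h i).one_le x hi).trans (le_ciSup (hbdd x) i)
    · simp [(h _).eq_zero x hx]
    · refine (isWeakUpperGradient_coe_iff hp).2
        ⟨.iSup fun i => (h i).isWeakUpperGradient.1, ?_⟩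
      filter_upwards [eventually_countable_forall.2 fun i =>
        ((isWeakUpperGradient_coe_iff hp).1 (h i).isWeakUpperGradient).2] with γ hγ
      exact edist_ciSup_ciSup_le (hbdd _) (hbdd _) fun i =>
        (hγ i).trans (lineIntegral_mono γ fun x => le_iSup (fun i => g i x) i)
  calc varCap p μ (⋃ i, A i) E ≤ ∫⁻ x, (⨆ i, g i x) ^ p ∂μ := hsup.varCap_le hp hE
    _ ≤ ∫⁻ x, ∑' i, g i x ^ p ∂μ := lintegral_mono fun x => iSup_rpow_le_tsum hp _
    _ = ∑' i, ∫⁻ x, g i x ^ p ∂μ :=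
        lintegral_tsum fun i => (h i).isWeakUpperGradient.1.pow_const p
    _ ≤ ∑' i, (varCap p μ (A i) E + δ i) := ENNReal.tsum_le_tsum fun i => (hl i).le
    _ = ∑' i, varCap p μ (A i) E + ∑' i, δ i := ENNReal.tsum_add
    _ ≤ _ := by gcongr

/-- A competitor for `∂F` can be redefined to be `1` on `F` without changing its upper gradient. -/
theorem Admissible.of_frontier (hp : 0 < p) {F : Set X} (hF : IsClosed F) (hFE : F ⊆ E)
    (h : Admissible p μ (frontier F) E v g) :
    ∃ w, Admissible p μ F E w g := by
  classical
  have hone : ∀ x ∈ frontier F, v x = 1 := fun x hx => le_antisymm (h.mem_Icc x).2 (h.one_le x hx)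
  refine ⟨F.piecewise (fun _ => 1) v, ?_, fun x => ?_, fun x hx => by simp [hx],
    fun x hx => ?_, (isWeakUpperGradient_coe_iff hp).2 ⟨h.isWeakUpperGradient.1, ?_⟩⟩
  · refine (((measurable_const (a := (1 : ℝ))).aemeasurable.indicator hF.measurableSet).add
      (h.aemeasurable.indicator hF.measurableSet.compl)).congr (Eventually.of_forall fun x => ?_)
    by_cases hx : x ∈ F <;> simp [hx]
  · by_cases hx : x ∈ F
    · simp [hx]
    · simpa [hx] using h.mem_Icc x
  · simp [show x ∉ F from fun h => hx (hFE h), h.eq_zero x hx]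
  · filter_upwards [eventually_incrementsLE hp h.isWeakUpperGradient] with γ hγ
    by_cases h0 : γ.toFun 0 ∈ F <;> by_cases h1 : γ.toFun γ.len ∈ F
    · simp [h0, h1]
    · obtain ⟨t, ht, htF⟩ := exists_last_mem_frontier hF h0 h1
      have := hγ t γ.len ht.1 ht.2 le_rfl
      simp only [hone _ htF] at this
      rw [piecewise_eq_of_mem _ _ _ h0, piecewise_eq_of_notMem _ _ _ h1]
      exact this.trans (lintegral_mono_set (Icc_subset_Icc_left ht.1))
    · obtain ⟨t, ht, htF⟩ := exists_first_mem_frontier hF h0 h1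
      have := hγ 0 t le_rfl ht.1 ht.2
      simp only [hone _ htF] at this
      rw [piecewise_eq_of_mem _ _ _ h1, piecewise_eq_of_notMem _ _ _ h0]
      exact this.trans (lintegral_mono_set (Icc_subset_Icc_right ht.2))
    · rw [piecewise_eq_of_notMem _ _ _ h0, piecewise_eq_of_notMem _ _ _ h1]
      exact hγ 0 γ.len le_rfl γ.len_pos.le le_rfl

theorem varCap_frontier [SecondCountableTopology X] (hp : 0 < p) (hE : μ E < ∞) {F : Set X}
    (hF : IsClosed F) (hFE : F ⊆ E) : varCap p μ F E = varCap p μ (frontier F) E := by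
  refine le_antisymm (le_of_forall_gt fun c hc => ?_) (varCap_mono hF.frontier_subset)
  obtain ⟨v, g, h, hl⟩ := exists_admissible_of_varCap_lt hc
  obtain ⟨w, hw⟩ := h.of_frontier hp hF hFE
  exact (hw.varCap_le hp hE).trans_lt hl

end Capacity

/-! ### Uniform convexity of the `p`-th power -/

theorem add_div_two_rpow_le {p : ℝ} (hp : 1 ≤ p) {a b : ℝ} (ha : 0 ≤ a) (hb : 0 ≤ b) :
    ((a + b) / 2) ^ p ≤ (a ^ p + b ^ p) / 2 := by
  have h := (convexOn_rpow hp).2 (mem_Ici.2 ha) (mem_Ici.2 hb) (show (0 : ℝ) ≤ 1 / 2 by norm_num)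
    (show (0 : ℝ) ≤ 1 / 2 by norm_num) (by norm_num)
  simp only [smul_eq_mul] at h
  calc ((a + b) / 2) ^ p = (1 / 2 * a + 1 / 2 * b) ^ p := by ring_nf
    _ ≤ _ := h
    _ = _ := by ring

/-- The case `a = 1`: on the compact set of `s ∈ [0, 1]` where `(1 - s) ^ p ≥ ε`, strict convexity
bounds the convexity gap from below. -/
theorem exists_one_sub_rpow_le {p : ℝ} (hp : 1 < p) {ε : ℝ} (hε : 0 < ε) :
    ∃ C : ℝ, 0 ≤ C ∧ ∀ s ∈ Icc (0 : ℝ) 1,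
      (1 - s) ^ p + C * ((1 + s) / 2) ^ p ≤ ε * (1 + s ^ p) + C * ((1 + s ^ p) / 2) := by
  have hp0 : 0 < p := one_pos.trans hp
  let ψ : ℝ → ℝ := fun s => (1 + s ^ p) / 2 - ((1 + s) / 2) ^ p
  have hψc : Continuous ψ :=
    ((continuous_const.add (Real.continuous_rpow_const hp0.le)).div_const 2).sub
      (((continuous_const.add continuous_id).div_const 2).rpow_const fun _ => Or.inr hp0.le)
  have hψ0 : ∀ s ∈ Icc (0 : ℝ) 1, 0 ≤ ψ s := fun s hs => by
    have := add_div_two_rpow_le hp.le zero_le_one hs.1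
    rw [Real.one_rpow] at this
    exact sub_nonneg.2 this
  let K : Set ℝ := {s ∈ Icc (0 : ℝ) 1 | ε ≤ (1 - s) ^ p}
  have hK : IsCompact K := isCompact_Icc.inter_right
    (isClosed_le continuous_const ((continuous_const.sub continuous_id).rpow_const
      fun _ => Or.inr hp0.le))
  have hψK : ∀ s ∈ K, 0 < ψ s := fun s hs => by
    have hs1 : (1 : ℝ) ≠ s := by
      rintro rfl
      have := hs.2
      rw [sub_self, Real.zero_rpow hp0.ne'] at this
      linarith
    have h := (strictConvexOn_rpow hp).2 (mem_Ici.2 zero_le_one) (mem_Ici.2 hs.1.1) hs1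
      (show (0 : ℝ) < 1 / 2 by norm_num) (show (0 : ℝ) < 1 / 2 by norm_num) (by norm_num)
    simp only [smul_eq_mul, Real.one_rpow] at h
    have e : (1 + s) / 2 = 1 / 2 * 1 + 1 / 2 * s := by ring
    simp only [ψ, e]
    linarith
  obtain ⟨δ, hδ, hδK⟩ : ∃ δ > 0, ∀ s ∈ K, δ ≤ ψ s := by
    rcases K.eq_empty_or_nonempty with hK0 | hne
    · exact ⟨1, one_pos, by simp [hK0]⟩
    · obtain ⟨s₀, hs₀, hmin⟩ := hK.exists_isMinOn hne hψc.continuousOn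
      exact ⟨ψ s₀, hψK s₀ hs₀, fun s hs => hmin hs⟩
  refine ⟨1 / δ, by positivity, fun s hs => ?_⟩
  have hsp : 0 ≤ s ^ p := Real.rpow_nonneg hs.1 p
  have hgap : (1 - s) ^ p ≤ ε * (1 + s ^ p) + 1 / δ * ψ s := by
    by_cases hsK : ε ≤ (1 - s) ^ p
    · have h1 : (1 - s) ^ p ≤ 1 :=
        Real.rpow_le_one (by linarith [hs.2]) (by linarith [hs.1]) hp0.le
      have h2 : 1 ≤ 1 / δ * ψ s := by
        rw [one_div, inv_mul_eq_div, one_le_div hδ]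
        exact hδK s ⟨hs, hsK⟩
      have : 0 ≤ ε * (1 + s ^ p) := by positivity
      linarith
    · have h1 : ε ≤ ε * (1 + s ^ p) := le_mul_of_one_le_right hε.le (by linarith)
      have h2 : 0 ≤ 1 / δ * ψ s := mul_nonneg (by positivity) (hψ0 s hs)
      linarith
  have : 1 / δ * ψ s = 1 / δ * ((1 + s ^ p) / 2) - 1 / δ * ((1 + s) / 2) ^ p := mul_sub _ _ _
  linarith

theorem exists_sub_rpow_le {p : ℝ} (hp : 1 < p) {ε : ℝ} (hε : 0 < ε) :
    ∃ C : ℝ, 0 ≤ C ∧ ∀ a b : ℝ, 0 ≤ b → b < a →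
      (a - b) ^ p + C * ((a + b) / 2) ^ p ≤ ε * (a ^ p + b ^ p) + C * ((a ^ p + b ^ p) / 2) := by
  obtain ⟨C, hC, h⟩ := exists_one_sub_rpow_le hp hε
  refine ⟨C, hC, fun a b hb hab => ?_⟩
  have ha : 0 < a := hb.trans_lt hab
  obtain ⟨s, rfl⟩ : ∃ s, b = a * s := ⟨b / a, by field_simp⟩
  have hs0 : 0 ≤ s := nonneg_of_mul_nonneg_right hb ha
  have hs1 : s < 1 := by
    by_contra! hs
    nlinarith
  have key := mul_le_mul_of_nonneg_left (h s ⟨hs0, hs1.le⟩) (Real.rpow_nonneg ha.le p)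
  have e1 : (a - a * s) ^ p = a ^ p * (1 - s) ^ p := by
    rw [← Real.mul_rpow ha.le (by linarith)]; ring_nf
  have e2 : ((a + a * s) / 2) ^ p = a ^ p * ((1 + s) / 2) ^ p := by
    rw [← Real.mul_rpow ha.le (by linarith)]; ring_nf
  have e3 : (a * s) ^ p = a ^ p * s ^ p := Real.mul_rpow ha.le hs0
  rw [e1, e2, e3]
  linarith

/-- Pointwise form of the uniform convexity of `L^p`, for all `1 < p < ∞` at once. -/
theorem exists_ennreal_sub_rpow_le {p : ℝ} (hp : 1 < p) {ε : ℝ≥0∞} (hε : ε ≠ 0) (hε' : ε ≠ ∞) :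
    ∃ C : ℝ≥0∞, C ≠ ∞ ∧ ∀ a b : ℝ≥0∞,
      (a - b) ^ p + C * (2⁻¹ * (a + b)) ^ p ≤ ε * (a ^ p + b ^ p) + C * (2⁻¹ * (a ^ p + b ^ p)) := by
  have hp0 : 0 < p := one_pos.trans hp
  obtain ⟨C, hC, h⟩ := exists_sub_rpow_le hp (ENNReal.toReal_pos hε hε')
  refine ⟨ENNReal.ofReal C, ENNReal.ofReal_ne_top, fun a b => ?_⟩
  rcases eq_or_ne a ∞ with rfl | ha
  · simp [hp0, hε]
  rcases eq_or_ne b ∞ with rfl | hb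
  · simp [hp0, hε]
  obtain ⟨a, ha0, rfl⟩ : ∃ r : ℝ, 0 ≤ r ∧ a = ENNReal.ofReal r :=
    ⟨a.toReal, ENNReal.toReal_nonneg, (ENNReal.ofReal_toReal ha).symm⟩
  obtain ⟨b, hb0, rfl⟩ : ∃ r : ℝ, 0 ≤ r ∧ b = ENNReal.ofReal r :=
    ⟨b.toReal, ENNReal.toReal_nonneg, (ENNReal.ofReal_toReal hb).symm⟩
  have hap := Real.rpow_nonneg ha0 p
  have hbp := Real.rpow_nonneg hb0 p
  have e2 : (2⁻¹ : ℝ≥0∞) = ENNReal.ofReal 2⁻¹ := by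
    rw [ENNReal.ofReal_inv_of_pos two_pos]; simp
  have emid : (2⁻¹ * (ENNReal.ofReal a + ENNReal.ofReal b)) ^ p
      = ENNReal.ofReal (((a + b) / 2) ^ p) := by
    rw [e2, ← ENNReal.ofReal_add ha0 hb0, ← ENNReal.ofReal_mul (by norm_num),
      ENNReal.ofReal_rpow_of_nonneg (by positivity) hp0.le]
    ring_nf
  have eavg : 2⁻¹ * (ENNReal.ofReal a ^ p + ENNReal.ofReal b ^ p)
      = ENNReal.ofReal ((a ^ p + b ^ p) / 2) := by
    rw [e2, ENNReal.ofReal_rpow_of_nonneg ha0 hp0.le, ENNReal.ofReal_rpow_of_nonneg hb0 hp0.le,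
      ← ENNReal.ofReal_add hap hbp, ← ENNReal.ofReal_mul (by norm_num)]
    ring_nf
  rw [emid, eavg]
  rcases le_or_gt a b with hab | hab
  · rw [tsub_eq_zero_of_le (ENNReal.ofReal_le_ofReal hab), ENNReal.zero_rpow_of_pos hp0, zero_add]
    refine le_trans ?_ le_add_self
    gcongr
    exact add_div_two_rpow_le hp.le ha0 hb0
  · rw [← ENNReal.ofReal_sub _ hb0, ENNReal.ofReal_rpow_of_nonneg (sub_nonneg.2 hab.le) hp0.le,
      ENNReal.ofReal_rpow_of_nonneg ha0 hp0.le, ENNReal.ofReal_rpow_of_nonneg hb0 hp0.le,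
      ← ENNReal.ofReal_add hap hbp, ← ENNReal.ofReal_toReal hε',
      ← ENNReal.ofReal_mul hC, ← ENNReal.ofReal_mul ENNReal.toReal_nonneg,
      ← ENNReal.ofReal_mul hC,
      ← ENNReal.ofReal_add (Real.rpow_nonneg (sub_nonneg.2 hab.le) p) (by positivity),
      ← ENNReal.ofReal_add (by positivity) (by positivity)]
    exact ENNReal.ofReal_le_ofReal (h a b hb0 hab)

/-! ### Limits of weak upper gradients -/

/-- A geometric bound for the decrease of a sequence bounds it by its lower limit. -/
theorem le_liminf_add_of_le_succ_add {a : ℕ → ℝ≥0∞} {ρ : ℝ≥0∞}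
    (h : ∀ j, a j ≤ a (j + 1) + 2⁻¹ ^ j * ρ) (j : ℕ) :
    a j ≤ liminf a atTop + 2 * 2⁻¹ ^ j * ρ := by
  have key : ∀ m j, a j ≤ a (j + m) + 2 * 2⁻¹ ^ j * ρ := by
    intro m
    induction m with
    | zero => intro j; exact le_self_add
    | succ m ih =>
      intro j
      have e : 2 * (2⁻¹ : ℝ≥0∞) ^ (j + 1) = 2⁻¹ ^ j := by
        rw [pow_succ', ← mul_assoc, ENNReal.mul_inv_cancel (by simp) (by simp), one_mul]
      calc a j ≤ a (j + 1) + 2⁻¹ ^ j * ρ := h j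
        _ ≤ a (j + 1 + m) + 2 * 2⁻¹ ^ (j + 1) * ρ + 2⁻¹ ^ j * ρ := by gcongr; exact ih (j + 1)
        _ = a (j + (m + 1)) + 2 * 2⁻¹ ^ j * ρ := by
          rw [e, add_assoc, ← two_mul, mul_assoc, add_assoc j 1 m, add_comm 1 m]
  rw [← tsub_le_iff_right]
  refine le_liminf_of_le (by isBoundedDefault) ?_
  filter_upwards [eventually_ge_atTop j] with k hk
  rw [tsub_le_iff_right]
  obtain ⟨m, rfl⟩ := Nat.exists_eq_add_of_le hk
  exact key m j

theorem aemeasurable_liminf {α : Type*} [MeasurableSpace α] {μ : Measure α} {g : ℕ → α → ℝ≥0∞}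
    (hg : ∀ j, AEMeasurable (g j) μ) :
    AEMeasurable (fun x => liminf (fun k => g k x) atTop) μ := by
  simp only [liminf_eq_iSup_iInf_of_nat']
  exact .iSup fun n => .iInf fun k => hg _

section Limits

variable {X : Type*} [MetricSpace X] [MeasurableSpace X] [BorelSpace X] {p : ℝ} {μ : Measure X}

/-- A form of Fuglede's lemma: if the positive parts of `g j - g (j + 1)` tend to `0` rapidly in
`L^p`, then along almost every curve the integral of `g j` exceeds that of the lower limit by at
most an error tending to `0`. The rate makes `ρ = ⨆ j, 2 ^ j * (g j - g (j + 1))` lie in `L^p`, so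
that the decrease is geometric at every point with the integrable factor `ρ`. -/
theorem eventually_lineIntegral_le_liminf (hp : 0 < p) {g : ℕ → X → ℝ≥0∞}
    (hg : ∀ j, AEMeasurable (g j) μ)
    (hd : ∀ j, ∫⁻ x, (g j x - g (j + 1) x) ^ p ∂μ ≤ 2⁻¹ ^ j * ((2 ^ j : ℝ≥0∞) ^ p)⁻¹) :
    ∀ᶠ γ in aeCurve μ hp, ∃ R : ℝ≥0∞, R ≠ ∞ ∧ ∀ j,
      lineIntegral γ (g j) ≤ lineIntegral γ (fun x => liminf (fun k => g k x) atTop) +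
        2 * 2⁻¹ ^ j * R := by
  let ρ : X → ℝ≥0∞ := fun x => ⨆ j, 2 ^ j * (g j x - g (j + 1) x)
  have hdm : ∀ j, AEMeasurable (fun x => g j x - g (j + 1) x) μ := fun j => (hg j).sub (hg (j + 1))
  have hρm : AEMeasurable ρ μ := .iSup fun j => (hdm j).const_mul _
  have hρ : ∫⁻ x, ρ x ^ p ∂μ < ∞ := by
    calc ∫⁻ x, ρ x ^ p ∂μ ≤ ∫⁻ x, ∑' j, (2 ^ j * (g j x - g (j + 1) x)) ^ p ∂μ :=
          lintegral_mono fun x => iSup_rpow_le_tsum hp _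
      _ = ∑' j, ∫⁻ x, (2 ^ j * (g j x - g (j + 1) x)) ^ p ∂μ :=
          lintegral_tsum fun j => ((hdm j).const_mul _).pow_const p
      _ ≤ ∑' j : ℕ, 2⁻¹ ^ j := by
          refine ENNReal.tsum_le_tsum fun j => ?_
          simp_rw [ENNReal.mul_rpow_of_nonneg _ _ hp.le]
          have h0 : ((2 : ℝ≥0∞) ^ j) ^ p ≠ 0 := by simp
          have h1 : ((2 : ℝ≥0∞) ^ j) ^ p ≠ ∞ :=
            ENNReal.rpow_ne_top_of_nonneg hp.le (ENNReal.pow_ne_top (by simp))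
          rw [lintegral_const_mul' _ _ h1]
          calc ((2 : ℝ≥0∞) ^ j) ^ p * ∫⁻ x, (g j x - g (j + 1) x) ^ p ∂μ
              ≤ (2 ^ j) ^ p * (2⁻¹ ^ j * ((2 ^ j : ℝ≥0∞) ^ p)⁻¹) := by gcongr; exact hd j
            _ = 2⁻¹ ^ j * (((2 : ℝ≥0∞) ^ j) ^ p * ((2 ^ j : ℝ≥0∞) ^ p)⁻¹) := by ring
            _ = 2⁻¹ ^ j := by rw [ENNReal.mul_inv_cancel h0 h1, mul_one]
      _ < ∞ := by rw [ENNReal.tsum_geometric, ENNReal.one_sub_inv_two, inv_inv]; simp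
  have hstep : ∀ x j, g j x ≤ g (j + 1) x + 2⁻¹ ^ j * ρ x := fun x j => by
    rw [← tsub_le_iff_left]
    calc g j x - g (j + 1) x = 2⁻¹ ^ j * (2 ^ j * (g j x - g (j + 1) x)) := by
          rw [← mul_assoc, ← mul_pow, ENNReal.inv_mul_cancel (by simp) (by simp), one_pow, one_mul]
      _ ≤ 2⁻¹ ^ j * ρ x := by
          gcongr
          exact le_iSup (fun j => 2 ^ j * (g j x - g (j + 1) x)) j
  filter_upwards [eventually_lineIntegral_lt_top hp hρm hρ, eventually_aemeasurable hp hρm]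
    with γ hγ hm
  refine ⟨lineIntegral γ ρ, hγ.ne, fun j => ?_⟩
  calc lineIntegral γ (g j)
      ≤ lineIntegral γ (fun x => liminf (fun k => g k x) atTop + 2 * 2⁻¹ ^ j * ρ x) :=
        lineIntegral_mono γ fun x => le_liminf_add_of_le_succ_add (hstep x) j
    _ = _ := by
        rw [lineIntegral, lintegral_add_right' _ (hm.const_mul _), lintegral_const_mul'' _ hm]
        rfl

/-- The upper limit of bounded functions, written as `⨅ n, ⨆ k, v (n + k)`, has the lower limit of
their weak upper gradients as a weak upper gradient. Being defined everywhere, the upper limit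
needs no exceptional set of points. -/
theorem isWeakUpperGradient_limsup (hp : 0 < p) {v : ℕ → X → ℝ} {g : ℕ → X → ℝ≥0∞}
    (hv : ∀ j x, v j x ∈ Icc (0 : ℝ) 1)
    (hg : ∀ j, IsWeakUpperGradient p μ (fun x => (v j x : EReal)) (g j))
    (hd : ∀ j, ∫⁻ x, (g j x - g (j + 1) x) ^ p ∂μ ≤ 2⁻¹ ^ j * ((2 ^ j : ℝ≥0∞) ^ p)⁻¹) :
    IsWeakUpperGradient p μ (fun x => ((⨅ n, ⨆ k, v (n + k) x : ℝ) : EReal))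
      (fun x => liminf (fun k => g k x) atTop) := by
  refine (isWeakUpperGradient_coe_iff hp).2 ⟨aemeasurable_liminf fun j => (hg j).1, ?_⟩
  filter_upwards [eventually_lineIntegral_le_liminf hp (fun j => (hg j).1) hd,
    eventually_countable_forall.2 fun j => ((isWeakUpperGradient_coe_iff hp).1 (hg j)).2]
    with γ ⟨R, hR, hγR⟩ hγ
  have hbdd : ∀ x n, BddAbove (range fun k => v (n + k) x) := fun x n =>
    ⟨1, forall_mem_range.2 fun k => (hv _ x).2⟩
  have hanti : ∀ x, Antitone fun n => ⨆ k, v (n + k) x := by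
    refine fun x => antitone_nat_of_succ_le fun n => ciSup_le fun k => ?_
    rw [add_assoc]
    exact le_ciSup (hbdd x n) (1 + k)
  have hlim : ∀ x, Tendsto (fun n => ⨆ k, v (n + k) x) atTop (𝓝 (⨅ n, ⨆ k, v (n + k) x)) :=
    fun x => tendsto_atTop_ciInf (hanti x)
      ⟨0, forall_mem_range.2 fun n => (hv (n + 0) x).1.trans (le_ciSup (hbdd x n) 0)⟩
  have hc : Tendsto (fun n : ℕ => lineIntegral γ (fun x => liminf (fun k => g k x) atTop) +
      2 * 2⁻¹ ^ n * R) atTop (𝓝 (lineIntegral γ (fun x => liminf (fun k => g k x) atTop))) := by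
    have h1 : Tendsto (fun n : ℕ => 2 * (2⁻¹ : ℝ≥0∞) ^ n * R) atTop (𝓝 (2 * 0 * R)) :=
      ENNReal.Tendsto.mul_const (ENNReal.Tendsto.const_mul
        (ENNReal.tendsto_pow_atTop_nhds_zero_of_lt_one (by simp)) (Or.inr (by simp))) (Or.inr hR)
    simpa using tendsto_const_nhds.add h1
  refine le_of_tendsto_of_tendsto' ((hlim _).edist (hlim _)) hc fun n => ?_
  refine edist_ciSup_ciSup_le (hbdd _ n) (hbdd _ n) fun k =>
    (hγ (n + k)).trans ((hγR (n + k)).trans ?_)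
  have : (2⁻¹ : ℝ≥0∞) ^ (n + k) ≤ 2⁻¹ ^ n :=
    pow_le_pow_of_le_one zero_le (by simp) (Nat.le_add_right n k)
  gcongr

end Limits

/-! ### Continuity along increasing sequences -/

section Continuity

variable {X : Type*} [MetricSpace X] [MeasurableSpace X] [BorelSpace X] {p : ℝ} {μ : Measure X}
  {A E : Set X}

theorem Admissible.midpoint (hp : 0 < p) {v w : X → ℝ} {g h : X → ℝ≥0∞}
    (hv : Admissible p μ A E v g) (hw : Admissible p μ A E w h) :
    Admissible p μ A E (fun x => 2⁻¹ * (v x + w x)) (fun x => 2⁻¹ * (g x + h x)) := by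
  refine ⟨(hv.aemeasurable.add hw.aemeasurable).const_mul _, fun x => ?_, fun x hx => ?_,
    fun x hx => ?_, (isWeakUpperGradient_coe_iff hp).2
      ⟨(hv.isWeakUpperGradient.1.add hw.isWeakUpperGradient.1).const_mul _, ?_⟩⟩
  · have h1 := hv.mem_Icc x
    have h2 := hw.mem_Icc x
    constructor <;> linarith [h1.1, h1.2, h2.1, h2.2]
  · linarith [hv.one_le x hx, hw.one_le x hx]
  · simp [hv.eq_zero x hx, hw.eq_zero x hx]
  · filter_upwards [((isWeakUpperGradient_coe_iff hp).1 hv.isWeakUpperGradient).2,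
      ((isWeakUpperGradient_coe_iff hp).1 hw.isWeakUpperGradient).2] with γ h1 h2
    have e : ∀ a b c d : ℝ, edist (2⁻¹ * (a + b)) (2⁻¹ * (c + d)) ≤
        2⁻¹ * (edist a c + edist b d) := by
      intro a b c d
      have : (2⁻¹ : ℝ≥0∞) = ENNReal.ofReal 2⁻¹ := by
        rw [ENNReal.ofReal_inv_of_pos two_pos]; simp
      rw [this, edist_dist, edist_dist, edist_dist, ← ENNReal.ofReal_add dist_nonneg dist_nonneg,
        ← ENNReal.ofReal_mul (by norm_num)]
      refine ENNReal.ofReal_le_ofReal ?_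
      simp only [Real.dist_eq]
      rw [← mul_sub, abs_mul, abs_of_pos (by norm_num : (0 : ℝ) < 2⁻¹), add_sub_add_comm]
      gcongr
      exact abs_add_le _ _
    calc _ ≤ _ := e _ _ _ _
      _ ≤ 2⁻¹ * (lineIntegral γ g + lineIntegral γ h) := by gcongr
      _ ≤ 2⁻¹ * ∫⁻ t in Icc 0 γ.len, (g (γ.toFun t) + h (γ.toFun t)) := by
          gcongr
          exact le_lintegral_add _ _
      _ ≤ _ := lintegral_const_mul_le _ _

/-- Near-minimizers for an increasing sequence of sets have Cauchy gradients: their midpoints are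
competitors for the smaller set, so uniform convexity applies. -/
theorem eventually_lintegral_sub_rpow_le [SecondCountableTopology X] (hp : 1 < p) (hE : μ E < ∞)
    {A : ℕ → Set X} (hA : Monotone A) (hL : ⨆ i, varCap p μ (A i) E ≠ ∞)
    {v : ℕ → X → ℝ} {g : ℕ → X → ℝ≥0∞} (h : ∀ j, Admissible p μ (A j) E (v j) (g j))
    (hg : ∀ j, ∫⁻ x, g j x ^ p ∂μ ≤ (⨆ i, varCap p μ (A i) E) + 2⁻¹ ^ j)
    {ε : ℝ≥0∞} (hε : ε ≠ 0) (hε' : ε ≠ ∞) :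
    ∀ᶠ k in atTop, ∀ l, k ≤ l → ∫⁻ x, (g k x - g l x) ^ p ∂μ ≤ ε := by
  have hp0 : 0 < p := one_pos.trans hp
  set L := ⨆ i, varCap p μ (A i) E with hLdef
  have hM0 : 2 * (L + 1) ≠ 0 := by simp
  have hM : 2 * (L + 1) ≠ ∞ :=
    ENNReal.mul_ne_top (by simp) (ENNReal.add_ne_top.2 ⟨hL, by simp⟩)
  have hε2 : ε / 2 ≠ 0 := by simpa using hε
  -- This constant makes the first error term at most `ε / 2`, as both energies are at most `L + 1`.
  obtain ⟨C, hC, hconv⟩ := exists_ennreal_sub_rpow_le hp (ε := ε / 2 / (2 * (L + 1)))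
    (ENNReal.div_pos hε2 hM).ne' (ENNReal.div_ne_top (ENNReal.div_ne_top hε' (by simp)) hM0)
  have hcap : Tendsto (fun k => varCap p μ (A k) E) atTop (𝓝 L) :=
    tendsto_atTop_iSup fun i j hij => varCap_mono (hA hij)
  have hpow : Tendsto (fun k : ℕ => (2⁻¹ : ℝ≥0∞) ^ k) atTop (𝓝 0) :=
    ENNReal.tendsto_pow_atTop_nhds_zero_of_lt_one (by simp)
  have hclose : ∀ᶠ k in atTop, C * (L + 2⁻¹ ^ k) < C * varCap p μ (A k) E + ε / 2 := by
    have h1 : Tendsto (fun k : ℕ => C * (L + 2⁻¹ ^ k)) atTop (𝓝 (C * (L + 0))) :=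
      ENNReal.Tendsto.const_mul (tendsto_const_nhds.add hpow) (Or.inr hC)
    have h2 : Tendsto (fun k => C * varCap p μ (A k) E + ε / 2) atTop (𝓝 (C * L + ε / 2)) :=
      (ENNReal.Tendsto.const_mul hcap (Or.inr hC)).add tendsto_const_nhds
    refine h1.eventually_lt h2 ?_
    rw [add_zero]
    exact ENNReal.lt_add_right (ENNReal.mul_ne_top hC hL) hε2
  filter_upwards [hclose] with k hk l hkl
  have hmk := (h k).isWeakUpperGradient.1
  have hml := (h l).isWeakUpperGradient.1
  have hle1 : ∀ j : ℕ, (2⁻¹ : ℝ≥0∞) ^ j ≤ 1 := fun j => pow_le_one₀ zero_le (by simp)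
  have hlk : (2⁻¹ : ℝ≥0∞) ^ l ≤ 2⁻¹ ^ k := pow_le_pow_of_le_one zero_le (by simp) hkl
  have hmid : varCap p μ (A k) E ≤ ∫⁻ x, (2⁻¹ * (g k x + g l x)) ^ p ∂μ :=
    ((h k).midpoint hp0 ((h l).mono (hA hkl))).varCap_le hp0 hE
  have hint := lintegral_mono (μ := μ) fun x => hconv (g k x) (g l x)
  have hsubm : AEMeasurable (fun x => (g k x - g l x) ^ p) μ := (hmk.sub hml).pow_const p
  have haddm : AEMeasurable (fun x => g k x ^ p + g l x ^ p) μ :=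
    (hmk.pow_const p).add (hml.pow_const p)
  rw [lintegral_add_left' hsubm, lintegral_const_mul' _ _ hC,
    lintegral_add_left' (haddm.const_mul _),
    lintegral_const_mul'' _ haddm,
    lintegral_const_mul' _ _ hC,
    lintegral_const_mul'' _ haddm,
    lintegral_add_left' (hmk.pow_const p)] at hint
  have hsum1 : ∫⁻ x, g k x ^ p ∂μ + ∫⁻ x, g l x ^ p ∂μ ≤ 2 * (L + 1) := by
    rw [two_mul]
    exact add_le_add ((hg k).trans (by gcongr; exact hle1 k))
      ((hg l).trans (by gcongr; exact hle1 l))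
  have hsum2 : 2⁻¹ * (∫⁻ x, g k x ^ p ∂μ + ∫⁻ x, g l x ^ p ∂μ) ≤ L + 2⁻¹ ^ k := by
    calc 2⁻¹ * (∫⁻ x, g k x ^ p ∂μ + ∫⁻ x, g l x ^ p ∂μ)
        ≤ 2⁻¹ * ((L + 2⁻¹ ^ k) + (L + 2⁻¹ ^ k)) := by
          gcongr
          · exact hg k
          · exact (hg l).trans (by gcongr)
      _ = L + 2⁻¹ ^ k := by
          rw [← two_mul, ← mul_assoc, ENNReal.inv_mul_cancel (by simp) (by simp), one_mul]
  have hfinal : ∫⁻ x, (g k x - g l x) ^ p ∂μ + C * varCap p μ (A k) E ≤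
      ε + C * varCap p μ (A k) E := by
    calc ∫⁻ x, (g k x - g l x) ^ p ∂μ + C * varCap p μ (A k) E
        ≤ ∫⁻ x, (g k x - g l x) ^ p ∂μ + C * ∫⁻ x, (2⁻¹ * (g k x + g l x)) ^ p ∂μ := by gcongr
      _ ≤ _ := hint
      _ ≤ ε / 2 / (2 * (L + 1)) * (2 * (L + 1)) + C * (L + 2⁻¹ ^ k) := by gcongr
      _ ≤ ε / 2 + (C * varCap p μ (A k) E + ε / 2) := by
          rw [ENNReal.div_mul_cancel hM0 hM]
          gcongr
      _ = ε + C * varCap p μ (A k) E := by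
          rw [add_comm (C * _), ← add_assoc, ENNReal.add_halves]
  have hkL : varCap p μ (A k) E ≤ L := le_iSup (fun i => varCap p μ (A i) E) k
  exact (ENNReal.add_le_add_iff_right
    (ENNReal.mul_ne_top hC (ne_top_of_le_ne_top hL hkL))).1 hfinal

theorem varCap_iUnion_le_iSup [SecondCountableTopology X] (hp : 1 < p) (hE : μ E < ∞)
    {A : ℕ → Set X} (hA : Monotone A) :
    varCap p μ (⋃ i, A i) E ≤ ⨆ i, varCap p μ (A i) E := by
  have hp0 : 0 < p := one_pos.trans hp
  rcases eq_or_ne (⨆ i, varCap p μ (A i) E) ∞ with hL | hL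
  · rw [hL]; exact le_top
  -- The `vⱼ` are near-minimizers; `φ` makes their gradients converge at a geometric rate.
  have hcapL : ∀ i, varCap p μ (A i) E ≤ ⨆ i, varCap p μ (A i) E :=
    le_iSup fun i => varCap p μ (A i) E
  have hlt : ∀ j, varCap p μ (A j) E < (⨆ i, varCap p μ (A i) E) + 2⁻¹ ^ j := fun j =>
    (hcapL j).trans_lt (ENNReal.lt_add_right hL (by simp))
  choose v g h hl using fun j => exists_admissible_of_varCap_lt (hlt j)
  have hδ : ∀ n : ℕ, (2⁻¹ : ℝ≥0∞) ^ n * ((2 ^ n : ℝ≥0∞) ^ p)⁻¹ ≠ 0 := fun n =>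
    mul_ne_zero (by simp) (ENNReal.inv_ne_zero.2
      (ENNReal.rpow_ne_top_of_nonneg hp0.le (ENNReal.pow_ne_top (by simp))))
  have hδ' : ∀ n : ℕ, (2⁻¹ : ℝ≥0∞) ^ n * ((2 ^ n : ℝ≥0∞) ^ p)⁻¹ ≠ ∞ := fun n =>
    ENNReal.mul_ne_top (ENNReal.pow_ne_top (by simp)) (ENNReal.inv_ne_top.2 (by simp))
  obtain ⟨φ, hφ, hφd⟩ := extraction_forall_of_eventually fun n =>
    eventually_lintegral_sub_rpow_le hp hE hA hL h (fun j => (hl j).le) (hδ n) (hδ' n)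
  have hbdd : ∀ x n, BddAbove (range fun k => v (φ (n + k)) x) := fun x n =>
    ⟨1, forall_mem_range.2 fun k => ((h _).mem_Icc x).2⟩
  have hlow : ∀ x n, 0 ≤ ⨆ k, v (φ (n + k)) x := fun x n =>
    ((h _).mem_Icc x).1.trans (le_ciSup (hbdd x n) 0)
  have hadm : Admissible p μ (⋃ i, A i) E (fun x => ⨅ n, ⨆ k, v (φ (n + k)) x)
      (fun x => liminf (fun k => g (φ k) x) atTop) := by
    refine ⟨.iInf fun n => .iSup fun k => (h _).aemeasurable, fun x => ⟨le_ciInf (hlow x), ?_⟩,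
      fun x hx => le_ciInf fun n => ?_, fun x hx => ?_,
      isWeakUpperGradient_limsup hp0 (v := fun j => v (φ j)) (g := fun j => g (φ j))
        (fun j => (h (φ j)).mem_Icc) (fun j => (h (φ j)).isWeakUpperGradient)
        fun j => hφd j _ (hφ.monotone j.le_succ)⟩
    · exact (ciInf_le ⟨0, forall_mem_range.2 (hlow x)⟩ 0).trans
        (ciSup_le fun k => ((h _).mem_Icc x).2)
    · obtain ⟨i, hi⟩ := mem_iUnion.1 hx
      have hle : i ≤ φ (n + i) := (Nat.le_add_left i n).trans (hφ.id_le _)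
      exact ((h _).one_le x (hA hle hi)).trans (le_ciSup (hbdd x n) i)
    · simp [(h _).eq_zero x hx]
  have hlim : Tendsto (fun k => (⨆ i, varCap p μ (A i) E) + (2⁻¹ : ℝ≥0∞) ^ φ k) atTop
      (𝓝 ((⨆ i, varCap p μ (A i) E) + 0)) :=
    tendsto_const_nhds.add ((ENNReal.tendsto_pow_atTop_nhds_zero_of_lt_one (by simp)).comp
      hφ.tendsto_atTop)
  calc varCap p μ (⋃ i, A i) E
      ≤ ∫⁻ x, (liminf (fun k => g (φ k) x) atTop) ^ p ∂μ := hadm.varCap_le hp0 hE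
    _ = ∫⁻ x, liminf (fun k => g (φ k) x ^ p) atTop ∂μ :=
        lintegral_congr fun x => (ENNReal.orderIsoRpow p hp0).liminf_apply
    _ ≤ liminf (fun k => ∫⁻ x, g (φ k) x ^ p ∂μ) atTop :=
        lintegral_liminf_le' fun k => (h (φ k)).isWeakUpperGradient.1.pow_const p
    _ ≤ liminf (fun k => (⨆ i, varCap p μ (A i) E) + (2⁻¹ : ℝ≥0∞) ^ φ k) atTop :=
        liminf_le_liminf (Eventually.of_forall fun k => (hl (φ k)).le)
    _ = ⨆ i, varCap p μ (A i) E := by rw [hlim.liminf_eq, add_zero]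

theorem tendsto_varCap_iUnion [SecondCountableTopology X] (hp : 1 < p) (hE : μ E < ∞)
    {A : ℕ → Set X} (hA : Monotone A) :
    Tendsto (fun i => varCap p μ (A i) E) atTop (𝓝 (varCap p μ (⋃ i, A i) E)) := by
  have h : varCap p μ (⋃ i, A i) E = ⨆ i, varCap p μ (A i) E :=
    le_antisymm (varCap_iUnion_le_iSup hp hE hA)
      (iSup_le fun i => varCap_mono (subset_iUnion A i))
  rw [h]
  exact tendsto_atTop_iSup fun i j hij => varCap_mono (hA hij)

/-- The outer measure on `E` given by the capacity. -/
noncomputable def varCapOuterMeasure [SecondCountableTopology X] (hp : 0 < p) (hE : μ E < ∞) :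
    OuterMeasure E where
  measureOf B := varCap p μ (Subtype.val '' B) E
  empty := by rw [image_empty]; exact varCap_empty hp hE
  mono hB := varCap_mono (image_mono hB)
  iUnion_nat B _ := by rw [image_iUnion]; exact varCap_iUnion_le hp hE _

end Continuity

end NewtonianCapacity

open NewtonianCapacity in
theorem theorem3p2 {X : Type*} [MetricSpace X] [MeasurableSpace X] [BorelSpace X]
    (μ : Measure X)
    (hμ : ∀ (x : X) (r : ℝ), 0 < r → 0 < μ (Metric.ball x r) ∧ μ (Metric.ball x r) < ∞)
    (p : ℝ) (hp : 1 ≤ p) (E : Set X) (hE : Bornology.IsBounded E) :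
    -- (i)
    varCap p μ ∅ E = 0 ∧
    -- (ii)
    (∀ A₁ A₂ : Set X, A₁ ⊆ A₂ → A₂ ⊆ E → varCap p μ A₁ E ≤ varCap p μ A₂ E) ∧
    -- (iii)
    (∀ A E₁ E₂ : Set X, Bornology.IsBounded E₂ → A ⊆ E₁ → E₁ ⊆ E₂ →
      varCap p μ A E₂ ≤ varCap p μ A E₁) ∧
    -- (iv)
    (∀ A₁ A₂ : Set X, A₁ ⊆ E → A₂ ⊆ E →
      varCap p μ (A₁ ∪ A₂) E + varCap p μ (A₁ ∩ A₂) E ≤ varCap p μ A₁ E + varCap p μ A₂ E) ∧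
    -- (v)
    (∀ A : ℕ → Set X, (∀ i, A i ⊆ E) →
      varCap p μ (⋃ i, A i) E ≤ ∑' i, varCap p μ (A i) E) ∧
    (∃ m : OuterMeasure E, ∀ B : Set E, m B = varCap p μ (Subtype.val '' B) E) ∧
    -- (vi)
    (1 < p → ∀ A : ℕ → Set X, Monotone A → (∀ i, A i ⊆ E) →
      Tendsto (fun i => varCap p μ (A i) E) atTop (𝓝 (varCap p μ (⋃ i, A i) E))) ∧
    -- (vii)
    (∀ F : Set X, IsClosed F → F ⊆ E → varCap p μ F E = varCap p μ (frontier F) E) := by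
  have hp0 : 0 < p := one_pos.trans_le hp
  have := secondCountableTopology_of_ball hμ
  have hμE : μ E < ∞ := by
    rcases E.eq_empty_or_nonempty with rfl | ⟨x, -⟩
    · simp
    · obtain ⟨r, hr, hsub⟩ := hE.subset_ball_lt 0 x
      exact (measure_mono hsub).trans_lt (hμ x r hr).2
  exact ⟨varCap_empty hp0 hμE, fun _ _ h _ => varCap_mono h, fun _ _ _ _ _ h => varCap_anti h,
    fun _ _ _ _ => varCap_union_add_varCap_inter_le hp0 hμE, fun A _ => varCap_iUnion_le hp0 hμE A,
    ⟨varCapOuterMeasure hp0 hμE, fun _ => rfl⟩, fun h _ hA _ => tendsto_varCap_iUnion h hμE hA,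
    fun _ hF hFE => varCap_frontier hp0 hμE hF hFE⟩
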